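/- Let $0<\gamma<1$, let $\theta$ be the Heaviside step function, and let $g_{-\gamma}=\frac{1}{\Gamma(1-\gamma)}D\big(\theta(t)t^{-\gamma}\big)$, where $D$ is the distributional derivative on $\mathbb{R}$. For $T\in(0,\infty]$, $u\in L^1_{loc}[0,T)$ and $u_0\in\mathbb{R}$, the generalized Caputo derivative of $u$ associated with the initial value $u_0$ is the distribution $D_c^\gamma u=g_{-\gamma}*\big((u-u_0)\theta\big)\in\mathscr{D}'(-\infty,T)$. A weak solution on $[0,T)$ of $D_c^\gamma u=f(t,u)$ with initial value $u_0$ is a function $u\in L^1_{loc}[0,T)$ such that $f(\cdot,u(\cdot))\in L^1_{loc}[0,T)$ and $D_c^\gamma u=\theta(t)f(t,u(t))$ in $\mathscr{D}'(-\infty,T)$. Let $f:[0,\infty)\times\mathbb{R}\to\mathbb{R}$ be a function in $L^\infty_{loc}([0,\infty)\times\mathbb{R})$ that is locally Lipschitz in $u$ in the following sense: for every compact $K\subset[0,\infty)\times\mathbb{R}$ there is $L_K>0$ such that, for a.e. $t$, $|f(t,u)-f(t,v)|\le L_K|u-v|$ for all $u,v$ with $(t,u),(t,v)\in K$. Then the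 following hold. 1. (Uniqueness) If $T_1,T_2\in(0,\infty]$ and $u_i\in L^\infty_{loc}[0,T_i)$ ($i=1,2$) are weak solutions on $[0,T_i)$ with the same initial value $u_0$, then $u_1=u_2$ a.e. on $[0,\min(T_1,T_2))$. 2. (Strict monotonicity) If $T_1,T_2\in(0,\infty]$ and $u_i\in L^\infty_{loc}[0,T_i)$ ($i=1,2$) are weak solutions on $[0,T_i)$ with initial values $u_{1,0}<u_{2,0}$, then each $u_i$ agrees a.e. with a continuous function on $[0,T_i)$ that takes the value $u_{i,0}$ at $t=0$, and these continuous versions satisfy $u_1(t)<u_2(t)$ for every $t\in[0,\min(T_1,T_2))$. 3. (Stability) For all $T,M>0$ there is a constant $C(M,T)>0$, depending only on $\gamma$, $f$, $M$ and $T$, such that any two weak solutions $u_i\in L^\infty_{loc}[0,T_i)$ with $T\le T_i\le\infty$, $\|u_i\|_{L^\infty[0,T]}\le M$ and initial values $u_{i,0}$ ($i=1,2$) satisfy $$\|u_1-u_2\|_{L^\infty[0,T]}\le C(M,T)\,|u_{1,0}-u_{2,0}|.$$ -/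

import Mathlib

open MeasureTheory Set
open scoped Distributions LineDeriv ENNReal

/-- The open interval `(-∞, T)`, where `T` may be `∞`. -/
def openBefore (T : EReal) : TopologicalSpace.Opens ℝ :=
  ⟨{t : ℝ | (t : EReal) < T}, isOpen_lt continuous_coe_real_ereal continuous_const⟩

/-- The half-open interval `[0, T)`, where `T` may be `∞`. -/
def timeInterval (T : EReal) : Set ℝ := {t : ℝ | 0 ≤ t ∧ (t : EReal) < T}

/-- The product `θ w` of a function `w` with the Heaviside step function. -/
noncomputable def cutoff (w : ℝ → ℝ) : ℝ → ℝ := (Ici (0 : ℝ)).indicator w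

/-- The distribution `φ ↦ ∫ w φ` on `Ω` given by a function `w` that is locally integrable
on `Ω`. -/
noncomputable def distOfFun (Ω : TopologicalSpace.Opens ℝ) (w : ℝ → ℝ) : 𝓓'(Ω, ℝ) :=
  ContinuousLinearMap.toUniformConvergenceCLM _ _ _
    (TestFunction.integralAgainstBilinCLM (ContinuousLinearMap.mul ℝ ℝ) volume w)

/-- For `-1 < β < 0`, the distribution `g_β = Γ(1+β)⁻¹ D(θ(t) t^β)` on `ℝ`, where `D` is the
distributional derivative. -/
noncomputable def gDist (β : ℝ) : 𝓓'((⊤ : TopologicalSpace.Opens ℝ), ℝ) :=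
  (1 / Real.Gamma (1 + β)) • ∂_{(1 : ℝ)} (distOfFun ⊤ (cutoff fun t => t ^ β))

/-- The translate `s ↦ φ (t + s)` of a test function, as a test function on `ℝ`. -/
noncomputable def translateTest {Ω : TopologicalSpace.Opens ℝ} (t : ℝ) (φ : 𝓓(Ω, ℝ)) :
    𝓓((⊤ : TopologicalSpace.Opens ℝ), ℝ) where
  toFun s := φ (t + s)
  contDiff' := φ.contDiff.comp (contDiff_const.add contDiff_id)
  hasCompactSupport' := φ.hasCompactSupport.comp_homeomorph (Homeomorph.addLeft t)
  tsupport_subset' := fun _ _ => trivial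

/-- The convolution `G * w` of a distribution `G` supported in `[0, ∞)` with a locally integrable
function `w` on `(-∞, T)` that vanishes on `(-∞, 0)`, as a functional on the test functions on
`(-∞, T)`: `⟨G * w, φ⟩ = ∫ w(t) ⟨G, φ(t + ·)⟩ dt`. -/
noncomputable def distConv (T : EReal) (G : 𝓓'((⊤ : TopologicalSpace.Opens ℝ), ℝ)) (w : ℝ → ℝ)
    (φ : 𝓓(openBefore T, ℝ)) : ℝ :=
  ∫ t in (openBefore T : Set ℝ), w t * G (translateTest t φ)

/-- The generalized Caputo derivative `D_c^γ u = g_{-γ} * ((u - u₀) θ)` of a function `u` on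
`[0, T)`, associated with the initial value `u₀`, as a functional on the test functions
on `(-∞, T)`. -/
noncomputable def caputoDeriv (γ : ℝ) (T : EReal) (u₀ : ℝ) (u : ℝ → ℝ) :
    𝓓(openBefore T, ℝ) → ℝ :=
  distConv T (gDist (-γ)) (cutoff fun t => u t - u₀)

/-- `u` is a weak solution on `[0, T)` of `D_c^γ u = f(t, u)` with initial value `u₀`. -/
structure IsWeakSolution (γ : ℝ) (f : ℝ → ℝ → ℝ) (T : EReal) (u₀ : ℝ) (u : ℝ → ℝ) : Prop where
  locallyIntegrable : LocallyIntegrableOn u (timeInterval T)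
  locallyIntegrable_rhs : LocallyIntegrableOn (fun t => f t (u t)) (timeInterval T)
  equation : ∀ φ : 𝓓(openBefore T, ℝ),
    caputoDeriv γ T u₀ u φ = distOfFun (openBefore T) (cutoff fun t => f t (u t)) φ

/-- `u ∈ L^∞_loc[0, T)`. -/
def IsLocBddOn (T : EReal) (u : ℝ → ℝ) : Prop :=
  ∀ a : ℝ, 0 ≤ a → (a : EReal) < T → MemLp u ∞ (volume.restrict (Icc 0 a))

/-- `f ∈ L^∞_loc([0, ∞) × ℝ)`. -/
def IsLocBddSource (f : ℝ → ℝ → ℝ) : Prop :=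
  ∀ K : Set (ℝ × ℝ), IsCompact K → K ⊆ Ici 0 ×ˢ univ →
    MemLp (fun p : ℝ × ℝ => f p.1 p.2) ∞ (volume.restrict K)

/-- `f` is locally Lipschitz in its second variable, for almost every value of the first one:
for each compact `K` there is `L > 0` such that, for almost every `t`,
`|f(t, u) - f(t, v)| ≤ L |u - v|` for all `u, v` with `(t, u), (t, v) ∈ K`. -/
def IsLocLipschitzSource (f : ℝ → ℝ → ℝ) : Prop :=
  ∀ K : Set (ℝ × ℝ), IsCompact K → K ⊆ Ici 0 ×ˢ univ →
    ∃ L : ℝ, 0 < L ∧ ∀ᵐ t : ℝ, ∀ u v : ℝ, (t, u) ∈ K → (t, v) ∈ K →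
      |f t u - f t v| ≤ L * |u - v|

/-- `v` is the continuous version on `[0, T)` of the almost-everywhere defined function `u`. -/
def IsContinuousVersion (T : EReal) (u v : ℝ → ℝ) : Prop :=
  ContinuousOn v (timeInterval T) ∧ u =ᵐ[volume.restrict (timeInterval T)] v

/-!
Write `k_β(t) = θ(t) t^β` and `J = ∫_0^∞ v^(γ-1) / (1+v) dv` (`betaConst`). The substitution
`v = c s / (a - s)` turns `J` into a one-parameter family of Beta-type integrals
(`integral_beta_moebius`), from which everything about the kernels is read off.

**From the weak equation to an Abel integral equation.** Taking `c = 1` gives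
`k_{-γ} * k_{γ-1} = J θ`. The weak equation is tested with the right-sided fractional integral
`φ(t) = ∫ k_{γ-1}(x - t) ψ(x) dx` of a test function `ψ`, cut off far to the left of `0`; the kernel
`k_{-γ}` undoes the fractional integral (`integral_powKernel_mul_rightFracIntegral_deriv`), and
Fubini's theorem yields
`u(t) = u₀ + κ ∫_0^t (t-s)^(γ-1) f(s, u(s)) ds` for a.e. `t`, with `κ = Γ(1-γ) / J > 0`
(`IsWeakSolution.ae_eq_abelIntegral`). As `f(s, u(s))` is locally bounded, the right-hand side is
Hölder continuous, and it is the continuous version of `u` (`mildVersion`).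

**Stability and uniqueness.** The difference of two solutions satisfies
`|d(t)| ≤ |d(0)| + κ L ∫_0^t (t-s)^(γ-1) |d(s)| ds`. In the norm `sup_t e^(-λt) |d(t)|` the integral
operator has norm at most `κ L Γ(γ) λ^(-γ)`, which is `1/2` for a suitable `λ`
(`abs_le_of_abel_gronwall`). Uniqueness is the case of equal initial values.

**Strict monotonicity.** Let `d = d₀ + κ k_{γ-1} * p` with `|p| ≤ L |d|`, and suppose that `τ` is the
first zero of `d`. Split the memory integral at `τ - δ`. Taking `c = δ / (y + δ)` in the
Beta-type integral over `(0, y)` gives the identity `integral_weight_mul_abelIntegral`: the history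
part `d₀ + κ ∫_0^(τ-δ) (τ-s)^(γ-1) p(s) ds`, the value at `τ` of the continuation of `d` with zero
fractional derivative after `τ - δ`, is bounded below by
`J⁻¹ δ^γ ∫_0^(τ-δ) x^(-γ) (δ+x)⁻¹ d(τ-δ-x) dx`, that is, by a positive multiple of `δ^γ`. The
remaining part is at least `-(κ L / γ) δ^γ` times the supremum of `d` over `[τ-δ, τ]`, hence
`o(δ^γ)` because `d(τ) = 0`. For small `δ` this contradicts `d(τ) = 0`
(`pos_of_abelIntegral_eq`).
-/

/-! ### Beta-type integrals and causal power kernels -/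

/-- The constant `J = ∫_0^∞ v^(γ-1) / (1+v) dv`, equal to the Beta integral `B(γ, 1-γ)`. Its closed
form `Γ(γ) Γ(1-γ)` is not needed, only its positivity. -/
noncomputable def betaConst (γ : ℝ) : ℝ := ∫ v in Ioi (0 : ℝ), v ^ (γ - 1) / (1 + v)

lemma integrableOn_rpow_div_one_add {γ : ℝ} (hγ₀ : 0 < γ) (hγ₁ : γ < 1) :
    IntegrableOn (fun v : ℝ => v ^ (γ - 1) / (1 + v)) (Ioi 0) := by
  have hm : ∀ s : Set ℝ, AEStronglyMeasurable (fun v : ℝ => v ^ (γ - 1) / (1 + v))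
      (volume.restrict s) := fun s => by
    apply Measurable.aestronglyMeasurable; fun_prop
  rw [← Ioc_union_Ioi_eq_Ioi (zero_le_one (α := ℝ))]
  refine IntegrableOn.union ?_ ?_
  · have h := (intervalIntegral.intervalIntegrable_rpow' (a := 0) (b := 1)
      (show -1 < γ - 1 by linarith)).1
    refine Integrable.mono' h (hm _) ?_
    filter_upwards [ae_restrict_mem measurableSet_Ioc] with v hv
    have h0 : 0 ≤ v ^ (γ - 1) := Real.rpow_nonneg hv.1.le _
    rw [Real.norm_of_nonneg (div_nonneg h0 (by linarith [hv.1]))]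
    exact div_le_self h0 (by linarith [hv.1])
  · have h := integrableOn_Ioi_rpow_of_lt (show γ - 2 < -1 by linarith) one_pos
    refine Integrable.mono' h (hm _) ?_
    filter_upwards [ae_restrict_mem measurableSet_Ioi] with v hv
    have hv0 : (0 : ℝ) < v := one_pos.trans hv
    have h0 : 0 ≤ v ^ (γ - 1) := Real.rpow_nonneg hv0.le _
    rw [Real.norm_of_nonneg (div_nonneg h0 (by linarith)), show γ - 2 = γ - 1 - 1 by ring,
      Real.rpow_sub_one hv0.ne' (γ - 1)]
    exact div_le_div_of_nonneg_left h0 hv0 (by linarith)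

lemma betaConst_pos {γ : ℝ} (hγ₀ : 0 < γ) (hγ₁ : γ < 1) : 0 < betaConst γ := by
  rw [betaConst, setIntegral_pos_iff_support_of_nonneg_ae _
    (integrableOn_rpow_div_one_add hγ₀ hγ₁)]
  · have : Ioi (0 : ℝ) ⊆ Function.support (fun v : ℝ => v ^ (γ - 1) / (1 + v)) ∩ Ioi 0 := by
      intro v hv
      have hv : 0 < v := hv
      exact ⟨(div_pos (Real.rpow_pos_of_pos hv _) (by linarith)).ne', hv⟩
    refine lt_of_lt_of_le ?_ (measure_mono this)
    simp
  · filter_upwards [ae_restrict_mem measurableSet_Ioi] with v hv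
    have hv : 0 < v := hv
    exact div_nonneg (Real.rpow_nonneg hv.le _) (by linarith)

/-- The substitution `v = c s / (a - s)`, which maps `(0, a)` onto `(0, ∞)`, in the integral defining
`betaConst γ`. -/
lemma integral_beta_moebius {γ a c : ℝ} (ha : 0 < a)
    (hc : 0 < c) :
    ∫ s in Ioo 0 a, s ^ (γ - 1) * (a - s) ^ (-γ) * (a / (a - (1 - c) * s)) =
      c ^ (-γ) * betaConst γ := by
  set G : ℝ → ℝ := fun s => c * s / (a - s) with hG
  set G' : ℝ → ℝ := fun s => c * a / (a - s) ^ 2 with hG'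
  have hderiv : ∀ s ∈ Ioo 0 a, HasDerivWithinAt G (G' s) (Ioo 0 a) s := by
    intro s hs
    have hne : a - s ≠ 0 := by linarith [hs.2]
    have h := ((hasDerivAt_id s).const_mul c).div ((hasDerivAt_id s).const_sub a) hne
    refine (h.congr_deriv ?_).hasDerivWithinAt
    simp only [hG', id]; congr 1; ring
  have hinj : InjOn G (Ioo 0 a) := by
    intro s hs t ht hst
    have h1 : a - s ≠ 0 := by linarith [hs.2]
    have h2 : a - t ≠ 0 := by linarith [ht.2]
    simp only [hG] at hst
    rw [div_eq_div_iff h1 h2] at hst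
    have : c * a * (s - t) = 0 := by linarith
    rcases mul_eq_zero.1 this with h | h
    · exact absurd h (mul_pos hc ha).ne'
    · linarith
  have himage : G '' Ioo 0 a = Ioi 0 := by
    ext v
    constructor
    · rintro ⟨s, hs, rfl⟩
      exact div_pos (mul_pos hc hs.1) (by linarith [hs.2])
    · intro hv
      have hv : 0 < v := hv
      have hcv : 0 < c + v := by linarith
      refine ⟨a * v / (c + v), ⟨by positivity, ?_⟩, ?_⟩
      · rw [div_lt_iff₀ hcv]; nlinarith
      · simp only [hG]
        have : a - a * v / (c + v) = a * c / (c + v) := by field_simp; ring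
        rw [this]; field_simp
  have hpt : ∀ s ∈ Ioo 0 a, |G' s| • ((G s) ^ (γ - 1) / (1 + G s)) =
      c ^ γ * (s ^ (γ - 1) * (a - s) ^ (-γ) * (a / (a - (1 - c) * s))) := by
    intro s hs
    have h1 : 0 < a - s := by linarith [hs.2]
    have h2 : 0 < a - (1 - c) * s := by nlinarith [hs.1, mul_pos hc hs.1]
    have hs0 := hs.1
    simp only [hG, hG', smul_eq_mul]
    rw [abs_of_pos (by positivity), Real.div_rpow (by positivity) h1.le,
      Real.mul_rpow hc.le hs0.le, Real.rpow_sub_one hc.ne' γ, Real.rpow_neg h1.le,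
      Real.rpow_sub_one h1.ne' γ]
    have h3 : 1 + c * s / (a - s) = (a - (1 - c) * s) / (a - s) := by field_simp; ring
    rw [h3]
    have := Real.rpow_pos_of_pos h1 γ
    field_simp
  have heq := integral_image_eq_integral_abs_deriv_smul measurableSet_Ioo hderiv hinj
    (fun v : ℝ => v ^ (γ - 1) / (1 + v))
  rw [himage, setIntegral_congr_fun measurableSet_Ioo hpt, integral_const_mul] at heq
  rw [betaConst, heq, ← mul_assoc, ← Real.rpow_add hc]; simp

/-- The causal power kernel `θ(t) t^β`. -/
noncomputable def powKernel (β : ℝ) : ℝ → ℝ := cutoff fun t => t ^ β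

lemma powKernel_of_nonneg {β x : ℝ} (hx : 0 ≤ x) : powKernel β x = x ^ β := by
  rw [powKernel, cutoff, indicator_of_mem (mem_Ici.2 hx)]

lemma powKernel_of_neg {β x : ℝ} (hx : x < 0) : powKernel β x = 0 := by
  rw [powKernel, cutoff, indicator_of_notMem (notMem_Ici.2 hx)]

lemma powKernel_nonneg (β x : ℝ) : 0 ≤ powKernel β x :=
  indicator_nonneg (fun _ hx => Real.rpow_nonneg hx _) x

lemma locallyIntegrable_powKernel {β : ℝ} (hβ : -1 < β) : LocallyIntegrable (powKernel β) := by
  have h : LocallyIntegrable (fun t : ℝ => t ^ β) := by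
    rw [locallyIntegrable_iff]
    intro K hK
    obtain ⟨b, hb⟩ := hK.isBounded.subset_closedBall 0
    refine IntegrableOn.mono_set ?_ hb
    rw [Real.closedBall_eq_Icc]
    rcases le_or_gt (0 - b) (0 + b) with h | h
    · rw [← intervalIntegrable_iff_integrableOn_Icc_of_le h]
      exact intervalIntegral.intervalIntegrable_rpow' hβ
    · rw [Icc_eq_empty (not_le.2 h)]; exact integrableOn_empty
  rw [locallyIntegrable_iff] at h ⊢
  intro K hK
  exact (h K hK).indicator measurableSet_Ici

lemma integrableOn_Iio_powKernel {β : ℝ} (hβ : -1 < β) (b : ℝ) :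
    IntegrableOn (powKernel β) (Iio b) := by
  have h := (locallyIntegrable_iff.1 (locallyIntegrable_powKernel hβ)) _ (isCompact_Icc (a := 0) (b := b))
  refine h.of_forall_sdiff_eq_zero measurableSet_Iio fun x hx => ?_
  refine powKernel_of_neg ?_
  by_contra hx0
  exact hx.2 ⟨not_lt.1 hx0, (mem_Iio.1 hx.1).le⟩

/-- The kernels `θ(t) t^(-γ)` and `θ(t) t^(γ-1)` are a Sonine pair: their convolution is constant on
`(0, ∞)`. -/
lemma integral_powKernel_mul_powKernel {γ y : ℝ} (hy : 0 < y) :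
    ∫ s, powKernel (-γ) s * powKernel (γ - 1) (y - s) = betaConst γ := by
  have h := integral_beta_moebius (γ := γ) hy one_pos
  have e : ∀ s, powKernel (-γ) (y - s) * powKernel (γ - 1) (y - (y - s)) =
      (Icc 0 y).indicator (fun s : ℝ => s ^ (γ - 1) * (y - s) ^ (-γ)) s := by
    intro s
    by_cases hs : s ∈ Icc 0 y
    · rw [indicator_of_mem hs, powKernel_of_nonneg (by linarith [hs.2]), sub_sub_cancel,
        powKernel_of_nonneg hs.1, mul_comm]
    · rw [indicator_of_notMem hs, sub_sub_cancel]
      rcases lt_or_ge s 0 with h0 | h0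
      · rw [powKernel_of_neg h0, mul_zero]
      · have : y < s := not_le.1 fun h' => hs ⟨h0, h'⟩
        rw [powKernel_of_neg (by linarith), zero_mul]
  rw [← integral_sub_left_eq_self _ volume y]
  simp_rw [e]
  rw [integral_indicator measurableSet_Icc, integral_Icc_eq_integral_Ioo]
  simpa [div_self hy.ne'] using h

/-! ### Fubini for causal kernels, fractional integrals of test functions -/

/-- Fubini's theorem `∫ h (k⋆g) = ∫ g (h * k)` for causal `h` and `k` that are only locally
integrable: as `g` vanishes from `b` on, only their restrictions to `(-∞, b)` matter. -/
lemma integral_causal_swap {h k g : ℝ → ℝ} {b : ℝ} (hh : IntegrableOn h (Iio b))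
    (hk : IntegrableOn k (Iio b)) (h0 : ∀ s < 0, h s = 0) (k0 : ∀ s < 0, k s = 0)
    (hg : AEStronglyMeasurable g) {B : ℝ} (hB : ∀ᵐ x, ‖g x‖ ≤ B) (gb : ∀ x, b ≤ x → g x = 0) :
    Integrable (fun x => g x * ∫ s, h s * k (x - s)) ∧
    ∫ s, h s * ∫ x, k (x - s) * g x = ∫ x, g x * ∫ s, h s * k (x - s) := by
  have hh' := hh.integrable_indicator measurableSet_Iio
  have hk' := hk.integrable_indicator measurableSet_Iio
  have hint := hh'.convolution_integrand (ContinuousLinearMap.mul ℝ ℝ) hk'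
  have hint2 := Integrable.bdd_mul (c := B) hint (hg.comp_fst (ν := volume))
    (Measure.quasiMeasurePreserving_fst.ae hB)
  have key : (fun p : ℝ × ℝ => g p.1 * (ContinuousLinearMap.mul ℝ ℝ)
      ((Iio b).indicator h p.2) ((Iio b).indicator k (p.1 - p.2))) =
      fun p : ℝ × ℝ => g p.1 * (h p.2 * k (p.1 - p.2)) := by
    ext ⟨x, s⟩
    simp only [ContinuousLinearMap.mul_apply']
    rcases le_or_gt b x with hx | hx
    · simp [gb x hx]
    rcases lt_or_ge s 0 with hs | hs
    · have : (Iio b).indicator h s = 0 := indicator_apply_eq_zero.2 fun _ => h0 s hs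
      rw [this, h0 s hs, zero_mul, zero_mul]
    rcases le_or_gt b s with hbs | hbs
    · have : (Iio b).indicator k (x - s) = 0 :=
        indicator_apply_eq_zero.2 fun _ => k0 _ (by linarith)
      rw [this, k0 (x - s) (by linarith)]; simp
    · rw [indicator_of_mem (mem_Iio.2 hbs), indicator_of_mem (mem_Iio.2 (by linarith))]
  rw [key] at hint2
  constructor
  · simpa only [integral_const_mul] using hint2.integral_prod_left
  · have := integral_integral_swap (f := fun x s => g x * (h s * k (x - s))) hint2
    simp only [← integral_const_mul]
    rw [this]
    congr 1; ext s; congr 1; ext x; ring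

section
variable {γ : ℝ}

/-- The right-sided fractional integral `t ↦ ∫_t^∞ (x - t)^(γ-1) ψ(x) dx` (without the factor
`1 / Γ(γ)`), written as a convolution with the reflected kernel. -/
noncomputable def rightFracIntegral (γ : ℝ) (ψ : ℝ → ℝ) : ℝ → ℝ :=
  convolution (fun x => powKernel (γ - 1) (-x)) ψ (ContinuousLinearMap.mul ℝ ℝ)

lemma rightFracIntegral_apply (γ : ℝ) (ψ : ℝ → ℝ) (t : ℝ) :
    rightFracIntegral γ ψ t = ∫ x, powKernel (γ - 1) (x - t) * ψ x := by
  rw [rightFracIntegral, convolution_def, ← integral_sub_left_eq_self _ volume t]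
  simp

lemma locallyIntegrable_powKernel_neg (hγ₀ : 0 < γ) :
    LocallyIntegrable fun x => powKernel (γ - 1) (-x) := by
  have h := locallyIntegrable_powKernel (β := γ - 1) (by linarith)
  rw [locallyIntegrable_iff] at h ⊢
  intro K hK
  have h2 := (h (-K) hK.neg)
  rw [← (Measure.measurePreserving_neg (volume : Measure ℝ)).integrableOn_comp_preimage
    (Homeomorph.neg ℝ).measurableEmbedding] at h2
  have e : Neg.neg ⁻¹' (-K) = K := by ext; simp
  rw [e] at h2
  exact h2

lemma contDiff_rightFracIntegral (hγ₀ : 0 < γ) {ψ : ℝ → ℝ} (hψ : ContDiff ℝ (⊤ : ℕ∞) ψ)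
    (hc : HasCompactSupport ψ) : ContDiff ℝ (⊤ : ℕ∞) (rightFracIntegral γ ψ) :=
  hc.contDiff_convolution_right _ (locallyIntegrable_powKernel_neg hγ₀) hψ

lemma hasDerivAt_rightFracIntegral (hγ₀ : 0 < γ) {ψ : ℝ → ℝ} (hψ : ContDiff ℝ (⊤ : ℕ∞) ψ)
    (hc : HasCompactSupport ψ) (t : ℝ) :
    HasDerivAt (rightFracIntegral γ ψ) (rightFracIntegral γ (deriv ψ) t) t :=
  hc.hasDerivAt_convolution_right _ (locallyIntegrable_powKernel_neg hγ₀)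
    (hψ.of_le (by exact_mod_cast le_top)) t

lemma rightFracIntegral_eq_zero {ψ : ℝ → ℝ} {b : ℝ} (hb : ∀ x, b ≤ x → ψ x = 0) {t : ℝ}
    (ht : b ≤ t) : rightFracIntegral γ ψ t = 0 := by
  rw [rightFracIntegral_apply]
  refine integral_eq_zero_of_ae (Filter.Eventually.of_forall fun x => ?_)
  rcases lt_or_ge x t with hx | hx
  · simp [powKernel_of_neg (show x - t < 0 by linarith)]
  · simp [hb x (ht.trans hx)]

/-- The kernel `θ(s) s^(-γ)`, integrated against the derivative of a right-sided fractional integral,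
returns the original test function. -/
lemma integral_powKernel_mul_rightFracIntegral_deriv (hγ₀ : 0 < γ) (hγ₁ : γ < 1) {ψ : ℝ → ℝ}
    (hψ : ContDiff ℝ (⊤ : ℕ∞) ψ) (hc : HasCompactSupport ψ) (t : ℝ) :
    ∫ s, powKernel (-γ) s * rightFracIntegral γ (deriv ψ) (t + s) = -(betaConst γ * ψ t) := by
  have hψ1 : ContDiff ℝ 1 ψ := hψ.of_le (by exact_mod_cast le_top)
  have hcont : Continuous (deriv ψ) := hψ1.continuous_deriv_one
  obtain ⟨b, hb⟩ := hc.isCompact.isBounded.subset_closedBall t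
  have hb' : ∀ x, b + 1 ≤ x → ψ (t + x) = 0 ∧ deriv ψ (t + x) = 0 := by
    intro x hx
    have hn : t + x ∉ tsupport ψ := fun h => by
      have := hb h
      rw [Metric.mem_closedBall, Real.dist_eq, add_sub_cancel_left] at this
      linarith [le_abs_self x]
    exact ⟨image_eq_zero_of_notMem_tsupport hn,
      image_eq_zero_of_notMem_tsupport fun h => hn (tsupport_deriv_subset h)⟩
  obtain ⟨B, hB⟩ := hcont.bounded_above_of_compact_support hc.deriv
  have e : ∀ s, rightFracIntegral γ (deriv ψ) (t + s) =
      ∫ x, powKernel (γ - 1) (x - s) * deriv ψ (t + x) := by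
    intro s
    rw [rightFracIntegral_apply, ← integral_add_left_eq_self _ t]
    simp
  simp_rw [e]
  have hcont_t : Continuous fun x => deriv ψ (t + x) :=
    hcont.comp (continuous_const.add continuous_id)
  rw [(integral_causal_swap (integrableOn_Iio_powKernel (by linarith) (b + 1))
    (integrableOn_Iio_powKernel (by linarith) (b + 1)) (fun _ => powKernel_of_neg)
    (fun _ => powKernel_of_neg)
    hcont_t.aestronglyMeasurable
    (Filter.Eventually.of_forall fun x => hB (t + x)) (fun x hx => (hb' x hx).2)).2]
  have hae : ∀ᵐ x : ℝ, deriv ψ (t + x) * ∫ s, powKernel (-γ) s * powKernel (γ - 1) (x - s) =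
      (Ioi 0).indicator (fun x => betaConst γ * deriv ψ (t + x)) x := by
    have : ∀ᵐ x : ℝ, x ≠ 0 := by simp [ae_iff]
    filter_upwards [this] with x hx
    rcases lt_or_gt_of_ne hx with h | h
    · rw [indicator_of_notMem (by simpa using h.le)]
      convert mul_zero _
      refine integral_eq_zero_of_ae (Filter.Eventually.of_forall fun s => ?_)
      rcases lt_or_ge s 0 with hs | hs
      · simp [powKernel_of_neg hs]
      · simp [powKernel_of_neg (show x - s < 0 by linarith)]
    · rw [indicator_of_mem (mem_Ioi.2 h), integral_powKernel_mul_powKernel h, mul_comm]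
  rw [integral_congr_ae hae, integral_indicator measurableSet_Ioi, integral_const_mul]
  have hsupp : HasCompactSupport fun x => deriv ψ (t + x) :=
    hc.deriv.comp_homeomorph (Homeomorph.addLeft t)
  have hFTC := integral_Ioi_of_hasDerivAt_of_tendsto' (a := 0) (m := 0) (f := fun x => ψ (t + x))
    (f' := fun x => deriv ψ (t + x)) (fun x _ => by
      have := (hψ1.differentiable one_ne_zero (t + x)).hasDerivAt.comp_const_add t x
      exact this)
    (hcont_t.integrable_of_hasCompactSupport hsupp).integrableOn
    (tendsto_const_nhds.congr' (by
      filter_upwards [Filter.eventually_ge_atTop (b + 1)] with x hx using (hb' x hx).1.symm))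
  rw [hFTC]; simp

end

lemma gDist_translateTest {T : EReal} (β : ℝ) (hβ : -1 < β) (t : ℝ) (φ : 𝓓(openBefore T, ℝ)) :
    gDist β (translateTest t φ) =
      -(1 / Real.Gamma (1 + β) * ∫ s, powKernel β s * deriv φ (t + s)) := by
  have hloc : LocallyIntegrableOn (cutoff fun t : ℝ => t ^ β)
      ((⊤ : TopologicalSpace.Opens ℝ) : Set ℝ) :=
    (locallyIntegrable_powKernel hβ).locallyIntegrableOn _
  have hd : ∀ s, (∂_{(1 : ℝ)} (translateTest t φ)) s = deriv φ (t + s) := by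
    intro s
    rw [TestFunction.lineDerivOp_eq_lineDerivCLM (𝕜 := ℝ), TestFunction.lineDerivCLM_apply_of_le
      (by simp), lineDeriv]
    change deriv (fun r : ℝ => φ (t + (s + r • (1 : ℝ)))) 0 = _
    simp only [smul_eq_mul, mul_one, ← add_assoc]
    rw [deriv_comp_const_add, add_zero]
  have : gDist β (translateTest t φ) = (1 / Real.Gamma (1 + β)) *
      (∂_{(1 : ℝ)} (distOfFun ⊤ (cutoff fun t => t ^ β))) (translateTest t φ) := rfl
  rw [this, Distribution.lineDerivOp_apply_apply, map_neg]
  have h2 : ∀ χ : 𝓓((⊤ : TopologicalSpace.Opens ℝ), ℝ), distOfFun ⊤ (cutoff fun t => t ^ β) χ =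
      ∫ x, χ x * cutoff (fun t => t ^ β) x := fun χ =>
    TestFunction.integralAgainstBilinCLM_eq_integral hloc
  rw [h2]
  rw [mul_neg]
  congr 2
  exact integral_congr_ae (Filter.Eventually.of_forall fun s => by
    simp only [hd]; exact mul_comm _ _)

/-! ### Weak solutions solve an Abel integral equation -/

/-- The Abel integral `∫_0^x (x - s)^(γ-1) h(s) ds` (without the factor `1 / Γ(γ)`); it is `0` for
`x ≤ 0`. -/
noncomputable def abelIntegral (γ : ℝ) (h : ℝ → ℝ) (x : ℝ) : ℝ :=
  ∫ s in Ioo 0 x, (x - s) ^ (γ - 1) * h s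

lemma integral_cutoff_mul_powKernel (γ : ℝ) (h : ℝ → ℝ) (x : ℝ) :
    ∫ s, cutoff h s * powKernel (γ - 1) (x - s) = abelIntegral γ h x := by
  have e : (fun s => cutoff h s * powKernel (γ - 1) (x - s)) =
      (Icc 0 x).indicator fun s => (x - s) ^ (γ - 1) * h s := by
    ext s
    by_cases hs : s ∈ Icc 0 x
    · rw [indicator_of_mem hs, powKernel_of_nonneg (by linarith [hs.2]), cutoff,
        indicator_of_mem (mem_Ici.2 hs.1), mul_comm]
    · rw [indicator_of_notMem hs]
      rcases lt_or_ge s 0 with h0 | h0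
      · rw [cutoff, indicator_of_notMem (notMem_Ici.2 h0), zero_mul]
      · have : x < s := not_le.1 fun h' => hs ⟨h0, h'⟩
        rw [powKernel_of_neg (by linarith), mul_zero]
  rw [e, integral_indicator measurableSet_Icc, integral_Icc_eq_integral_Ioo, abelIntegral]

lemma cutoff_of_nonneg {w : ℝ → ℝ} {x : ℝ} (hx : 0 ≤ x) : cutoff w x = w x := by
  rw [cutoff, indicator_of_mem (mem_Ici.2 hx)]

lemma cutoff_of_neg {w : ℝ → ℝ} {x : ℝ} (hx : x < 0) : cutoff w x = 0 := by
  rw [cutoff, indicator_of_notMem (notMem_Ici.2 hx)]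

lemma Icc_subset_timeInterval {T : EReal} {b : ℝ} (hb : (b : EReal) < T) :
    Icc 0 b ⊆ timeInterval T := fun _ hx =>
  ⟨hx.1, lt_of_le_of_lt (EReal.coe_le_coe_iff.2 hx.2) hb⟩

section
variable {T : EReal} {w : ℝ → ℝ}

lemma integrableOn_Iio_cutoff (hw : LocallyIntegrableOn w (timeInterval T))
    {b : ℝ} (hb : (b : EReal) < T) : IntegrableOn (cutoff w) (Iio b) := by
  have h : IntegrableOn (cutoff w) (Icc 0 b) :=
    (hw.integrableOn_compact_subset (Icc_subset_timeInterval hb) isCompact_Icc).indicator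
      measurableSet_Ici
  refine h.of_forall_sdiff_eq_zero measurableSet_Iio fun x hx => cutoff_of_neg ?_
  by_contra hx0
  exact hx.2 ⟨not_lt.1 hx0, (mem_Iio.1 hx.1).le⟩

lemma locallyIntegrableOn_cutoff_openBefore (hw : LocallyIntegrableOn w (timeInterval T)) :
    LocallyIntegrableOn (cutoff w) (openBefore T) := by
  rw [locallyIntegrableOn_iff (openBefore T).isOpen.isLocallyClosed]
  intro K hKT hK
  have h : IntegrableOn (cutoff w) (K ∩ Ici 0) :=
    (hw.integrableOn_compact_subset (fun x hx => ⟨hx.2, hKT hx.1⟩)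
      (hK.inter_right isClosed_Ici)).indicator measurableSet_Ici
  refine h.of_forall_sdiff_eq_zero hK.measurableSet fun x hx => cutoff_of_neg ?_
  by_contra hx0
  exact hx.2 ⟨hx.1, not_lt.1 hx0⟩

lemma distOfFun_apply {Ω : TopologicalSpace.Opens ℝ} (hw : LocallyIntegrableOn w Ω)
    (φ : 𝓓(Ω, ℝ)) : distOfFun Ω w φ = ∫ x, φ x * w x :=
  TestFunction.integralAgainstBilinCLM_eq_integral hw

/-- A right-sided fractional integral does not have compact support, but on `[0, ∞)`, the only place
where the weak equation sees it, it agrees with a test function. -/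
lemma exists_test_of_rightFracIntegral {γ : ℝ} (hγ₀ : 0 < γ) {ψ : ℝ → ℝ} {b : ℝ}
    (hψ : ContDiff ℝ (⊤ : ℕ∞) ψ) (hc : HasCompactSupport ψ) (hb : (b : EReal) < T)
    (hψb : ∀ x, b ≤ x → ψ x = 0) :
    ∃ φ : 𝓓(openBefore T, ℝ), ∀ t, 0 ≤ t →
      φ t = rightFracIntegral γ ψ t ∧ deriv φ t = rightFracIntegral γ (deriv ψ) t := by
  set F : ℝ → ℝ := fun t => Real.smoothTransition (t + 2) * rightFracIntegral γ ψ t with hF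
  have hFd : ContDiff ℝ (⊤ : ℕ∞) F :=
    (Real.smoothTransition.contDiff.comp (contDiff_id.add contDiff_const)).mul
      (contDiff_rightFracIntegral hγ₀ hψ hc)
  have hFs : Function.support F ⊆ Icc (-2) b := by
    intro t ht
    by_contra hn
    refine ht ?_
    rcases lt_or_ge t (-2) with h | h
    · simp only [hF]
      rw [Real.smoothTransition.zero_of_nonpos (by linarith), zero_mul]
    · have : b < t := not_le.1 fun h' => hn ⟨h, h'⟩
      simp only [hF]
      rw [rightFracIntegral_eq_zero hψb this.le, mul_zero]
  have hFt : tsupport F ⊆ Icc (-2) b := closure_minimal hFs isClosed_Icc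
  refine ⟨⟨F, hFd, HasCompactSupport.of_support_subset_isCompact isCompact_Icc hFs,
    fun x hx => lt_of_le_of_lt (EReal.coe_le_coe_iff.2 (hFt hx).2) hb⟩, fun t ht => ?_⟩
  have hone : ∀ s : ℝ, -1 < s → F s = rightFracIntegral γ ψ s := fun s hs => by
    simp only [hF]
    rw [Real.smoothTransition.one_of_one_le (by linarith), one_mul]
  refine ⟨hone t (by linarith), ?_⟩
  have hev : F =ᶠ[nhds t] rightFracIntegral γ ψ := by
    filter_upwards [Ioi_mem_nhds (show -1 < t by linarith)] with s hs using hone s hs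
  change deriv F t = _
  rw [hev.deriv_eq]
  exact (hasDerivAt_rightFracIntegral hγ₀ hψ hc t).deriv

/-- The factor `κ = Γ(1-γ) / J` in front of the Abel integral (in closed form, `1 / Γ(γ)`). -/
noncomputable def abelConst (γ : ℝ) : ℝ := Real.Gamma (1 - γ) / betaConst γ

lemma abelConst_pos {γ : ℝ} (hγ₀ : 0 < γ) (hγ₁ : γ < 1) : 0 < abelConst γ :=
  div_pos (Real.Gamma_pos_of_pos (by linarith)) (betaConst_pos hγ₀ hγ₁)

lemma exists_bound_of_compact_subset {K : Set ℝ} (hK : IsCompact K) (hT : 0 < T)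
    (hKT : ∀ x ∈ K, (x : EReal) < T) : ∃ b : ℝ, 0 < b ∧ (b : EReal) < T ∧ ∀ x ∈ K, x < b := by
  obtain ⟨m, hm, hmax⟩ := (hK.insert 0).exists_isGreatest (insert_nonempty _ _)
  have hmT : (m : EReal) < T := by
    rcases hm with rfl | hm
    · exact_mod_cast hT
    · exact hKT m hm
  obtain ⟨b, hmb, hbT⟩ := EReal.lt_iff_exists_real_btwn.1 hmT
  have hmb : m < b := by exact_mod_cast hmb
  exact ⟨b, lt_of_le_of_lt (hmax (mem_insert _ _)) hmb, hbT,
    fun x hx => lt_of_le_of_lt (hmax (mem_insert_of_mem _ hx)) hmb⟩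

lemma integrableOn_abelIntegral {γ : ℝ} (hγ₀ : 0 < γ) (hw : LocallyIntegrableOn w (timeInterval T))
    {b : ℝ} (hb : (b : EReal) < T) : IntegrableOn (abelIntegral γ w) (Iio b) := by
  have h := (integral_causal_swap (g := (Iio b).indicator 1) (B := 1)
    (integrableOn_Iio_cutoff hw hb)
    (integrableOn_Iio_powKernel (show -1 < γ - 1 by linarith) b) (fun _ => cutoff_of_neg)
    (fun _ => powKernel_of_neg) (by
      exact (aestronglyMeasurable_const (b := (1:ℝ))).indicator measurableSet_Iio)
    (Filter.Eventually.of_forall fun x => (norm_indicator_le_norm_self _ _).trans (by simp))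
    (fun x hx => indicator_of_notMem (notMem_Iio.2 hx) _)).1
  simp only [integral_cutoff_mul_powKernel] at h
  rw [← integrable_indicator_iff measurableSet_Iio]
  refine h.congr (Filter.Eventually.of_forall fun x => ?_)
  by_cases hx : x ∈ Iio b <;> simp [hx]

/-- A weak solution satisfies `u = u₀ + κ ∫_0^t (t - s)^(γ-1) f(s, u(s)) ds` almost everywhere. -/
theorem IsWeakSolution.ae_eq_abelIntegral {γ : ℝ} (hγ₀ : 0 < γ) (hγ₁ : γ < 1) {f : ℝ → ℝ → ℝ}
    {u : ℝ → ℝ} {u₀ : ℝ} (hT : 0 < T) (hu : IsWeakSolution γ f T u₀ u) :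
    ∀ᵐ t ∂(volume.restrict (timeInterval T)),
      u t = u₀ + abelConst γ * abelIntegral γ (fun t => f t (u t)) t := by
  have hh := hu.locallyIntegrable_rhs
  set h : ℝ → ℝ := fun t => f t (u t) with hdef
  have hw : LocallyIntegrableOn (fun t => u t - u₀) (timeInterval T) :=
    hu.locallyIntegrable.sub (locallyIntegrableOn_const _)
  have hJ := betaConst_pos hγ₀ hγ₁
  have hΓ : 0 < Real.Gamma (1 - γ) := Real.Gamma_pos_of_pos (by linarith)
  set U : Set ℝ := {t | 0 < t ∧ (t : EReal) < T} with hUdef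
  have hU : IsOpen U := isOpen_Ioi.inter (openBefore T).isOpen
  have key : ∀ᵐ t, t ∈ U → u t - u₀ - abelConst γ * abelIntegral γ h t = 0 := by
    refine hU.ae_eq_zero_of_integral_contDiff_smul_eq_zero ?_ fun ψ hψ hc hψU => ?_
    · rw [locallyIntegrableOn_iff hU.isLocallyClosed]
      intro K hKU hK
      obtain ⟨b, -, hbT, hKb⟩ := exists_bound_of_compact_subset hK hT fun x hx => (hKU hx).2
      exact (hw.integrableOn_compact_subset (fun x hx => ⟨(hKU hx).1.le, (hKU hx).2⟩) hK).sub
        (((integrableOn_abelIntegral hγ₀ hh hbT).mono_set hKb).const_mul _)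
    · obtain ⟨b, hb0, hbT, hKb⟩ := exists_bound_of_compact_subset hc.isCompact hT
        fun x hx => (hψU hx).2
      have hψb : ∀ x, b ≤ x → ψ x = 0 := fun x hx => by
        by_contra hn
        exact absurd (hKb x (subset_tsupport _ hn)) (not_lt.2 hx)
      have hψ0 : ∀ x, x ≤ 0 → ψ x = 0 := fun x hx => by
        by_contra hn
        exact absurd (hψU (subset_tsupport _ hn)).1 (not_lt.2 hx)
      obtain ⟨B, hB⟩ := hψ.continuous.bounded_above_of_compact_support hc
      obtain ⟨φ, hφ⟩ := exists_test_of_rightFracIntegral hγ₀ hψ hc hbT hψb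
      have heq := hu.equation φ
      rw [distOfFun_apply (locallyIntegrableOn_cutoff_openBefore hh), caputoDeriv, distConv] at heq
      have e1 : ∀ t, cutoff (fun t => u t - u₀) t * gDist (-γ) (translateTest t φ) =
          (betaConst γ / Real.Gamma (1 - γ)) * (ψ t * (u t - u₀)) := by
        intro t
        rcases lt_or_ge t 0 with ht | ht
        · rw [cutoff_of_neg ht, hψ0 t ht.le]; simp
        · rw [gDist_translateTest (-γ) (by linarith), cutoff_of_nonneg ht]
          have : ∫ s, powKernel (-γ) s * deriv φ (t + s) =
              ∫ s, powKernel (-γ) s * rightFracIntegral γ (deriv ψ) (t + s) := by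
            congr 1; ext s
            rcases lt_or_ge s 0 with hs | hs
            · rw [powKernel_of_neg hs, zero_mul, zero_mul]
            · rw [(hφ (t + s) (by linarith)).2]
          rw [this, integral_powKernel_mul_rightFracIntegral_deriv hγ₀ hγ₁ hψ hc,
            ← sub_eq_add_neg]
          field_simp
      have e2 : ∀ x, φ x * cutoff h x =
          cutoff h x * ∫ y, powKernel (γ - 1) (y - x) * ψ y := by
        intro x
        rcases lt_or_ge x 0 with hx | hx
        · rw [cutoff_of_neg hx]; simp
        · rw [(hφ x hx).1, rightFracIntegral_apply, mul_comm]
      have hswap := integral_causal_swap (integrableOn_Iio_cutoff hh hbT)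
        (integrableOn_Iio_powKernel (show -1 < γ - 1 by linarith) b) (fun _ => cutoff_of_neg)
        (fun _ => powKernel_of_neg) hψ.continuous.aestronglyMeasurable
        (Filter.Eventually.of_forall hB) hψb
      simp only [integral_cutoff_mul_powKernel] at hswap
      have e3 : ∫ t in (openBefore T : Set ℝ), ψ t * (u t - u₀) = ∫ t, ψ t * (u t - u₀) := by
        refine setIntegral_eq_integral_of_forall_compl_eq_zero fun t ht => ?_
        have : ψ t = 0 := by
          by_contra hn
          exact ht (hψU (subset_tsupport _ hn)).2
        rw [this, zero_mul]
      simp_rw [e1, e2] at heq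
      rw [hswap.2, integral_const_mul, e3] at heq
      have hint : Integrable fun t => ψ t * (u t - u₀) := by
        have h1 : IntegrableOn (fun t => ψ t * (u t - u₀)) (tsupport ψ) :=
          (hw.integrableOn_compact_subset (fun x hx => ⟨(hψU hx).1.le, (hψU hx).2⟩)
            hc.isCompact).bdd_mul (c := B) hψ.continuous.aestronglyMeasurable
            (Filter.Eventually.of_forall hB)
        rw [integrableOn_iff_integrable_of_support_subset] at h1
        · exact h1
        · intro t ht
          exact subset_tsupport _ fun h0 => ht (by simp [h0])
      have e4 : ∀ t, ψ t • (u t - u₀ - abelConst γ * abelIntegral γ h t) =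
          ψ t * (u t - u₀) - abelConst γ * (ψ t * abelIntegral γ h t) := fun t => by
        rw [smul_eq_mul]; ring
      simp_rw [e4]
      rw [integral_sub hint (hswap.1.const_mul _), integral_const_mul, ← heq, abelConst]
      field_simp
      ring
  have h0 : ∀ᵐ t : ℝ, t ≠ 0 := by simp [ae_iff]
  have hm : MeasurableSet (timeInterval T) :=
    measurableSet_Ici.inter (openBefore T).isOpen.measurableSet
  rw [ae_restrict_iff' hm]
  filter_upwards [key, h0] with t ht ht0 htT
  linarith [ht ⟨lt_of_le_of_ne htT.1 (Ne.symm ht0), htT.2⟩]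

end

/-! ### Estimates for Abel integrals and a Gronwall inequality -/

section
variable {γ : ℝ} {h : ℝ → ℝ}

lemma integrableOn_sub_rpow (hγ₀ : 0 < γ) (x a b : ℝ) :
    IntegrableOn (fun s => (x - s) ^ (γ - 1)) (Ioo a b) := by
  rcases le_or_gt a b with hab | hab
  · have h := (intervalIntegral.intervalIntegrable_rpow' (a := x - a) (b := x - b)
      (show -1 < γ - 1 by linarith)).comp_sub_left x
    simp only [sub_sub_cancel] at h
    exact ((intervalIntegrable_iff_integrableOn_Ioc_of_le hab).1 h).mono_set Ioo_subset_Ioc_self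
  · rw [Ioo_eq_empty (by linarith)]; exact integrableOn_empty

lemma integral_Ioo_sub_rpow (hγ₀ : 0 < γ) {x a b : ℝ} (hab : a ≤ b) :
    ∫ s in Ioo a b, (x - s) ^ (γ - 1) = ((x - a) ^ γ - (x - b) ^ γ) / γ := by
  rw [← integral_Ioc_eq_integral_Ioo, ← intervalIntegral.integral_of_le hab,
    intervalIntegral.integral_comp_sub_left (fun r => r ^ (γ - 1)) x,
    integral_rpow (Or.inl (by linarith)), sub_add_cancel]

lemma integrableOn_sub_rpow_mul (hγ₀ : 0 < γ) {x a b B : ℝ}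
    (hh : AEStronglyMeasurable h (volume.restrict (Ioo a b)))
    (hB : ∀ᵐ s ∂(volume.restrict (Ioo a b)), |h s| ≤ B) :
    IntegrableOn (fun s => (x - s) ^ (γ - 1) * h s) (Ioo a b) :=
  (integrableOn_sub_rpow hγ₀ x a b).mul_bdd (c := B) hh hB

lemma abs_integral_Ioo_sub_rpow_mul_le (hγ₀ : 0 < γ) {x a b B : ℝ} (hab : a ≤ b) (hbx : b ≤ x)
    (hB : ∀ᵐ s ∂(volume.restrict (Ioo a b)), |h s| ≤ B) :
    |∫ s in Ioo a b, (x - s) ^ (γ - 1) * h s| ≤ B * (((x - a) ^ γ - (x - b) ^ γ) / γ) := by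
  rw [← integral_Ioo_sub_rpow hγ₀ hab, ← integral_const_mul]
  rw [← Real.norm_eq_abs]
  refine norm_integral_le_of_norm_le
    (Integrable.const_mul (integrableOn_sub_rpow hγ₀ x a b) B) ?_
  filter_upwards [hB, ae_restrict_mem measurableSet_Ioo] with s hs hsm
  have h0 : 0 ≤ (x - s) ^ (γ - 1) := Real.rpow_nonneg (by linarith [hsm.2]) _
  rw [Real.norm_eq_abs, abs_mul, abs_of_nonneg h0, mul_comm]
  exact mul_le_mul_of_nonneg_right hs h0

lemma integral_Ioo_split {F : ℝ → ℝ} {a b c : ℝ} (hab : a ≤ b) (hbc : b ≤ c)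
    (h1 : IntegrableOn F (Ioo a b)) (h2 : IntegrableOn F (Ioo b c)) :
    ∫ s in Ioo a c, F s = (∫ s in Ioo a b, F s) + ∫ s in Ioo b c, F s := by
  simp only [← integral_Ioc_eq_integral_Ioo]
  rw [← Ioc_union_Ioc_eq_Ioc hab hbc]
  exact setIntegral_union (Ioc_disjoint_Ioc_of_le le_rfl) measurableSet_Ioc
    ((integrableOn_Ioc_iff_integrableOn_Ioo).2 h1) ((integrableOn_Ioc_iff_integrableOn_Ioo).2 h2)

lemma ae_restrict_Ioo_of_Icc {P : ℝ → Prop} {a b x y : ℝ}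
    (hP : ∀ᵐ s ∂(volume.restrict (Icc a b)), P s) (hx : a ≤ x) (hy : y ≤ b) :
    ∀ᵐ s ∂(volume.restrict (Ioo x y)), P s :=
  ae_restrict_of_ae_restrict_of_subset (t := Icc a b)
    (fun _ hs => ⟨hx.trans hs.1.le, hs.2.le.trans hy⟩) hP

/-- The Abel integral of a bounded function is `γ`-Hölder continuous. -/
lemma abs_abelIntegral_sub_le (hγ₀ : 0 < γ) (hγ₁ : γ < 1) {a B x y : ℝ}
    (hh : AEStronglyMeasurable h (volume.restrict (Icc 0 a)))
    (hB : ∀ᵐ s ∂(volume.restrict (Icc 0 a)), |h s| ≤ B) (hB0 : 0 ≤ B) (hx : 0 ≤ x) (hxy : x ≤ y)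
    (hy : y ≤ a) : |abelIntegral γ h y - abelIntegral γ h x| ≤ 2 * B / γ * (y - x) ^ γ := by
  have hm : ∀ {p q : ℝ}, 0 ≤ p → q ≤ a → AEStronglyMeasurable h (volume.restrict (Ioo p q)) :=
    fun hp hq => hh.mono_measure (Measure.restrict_mono_set volume
      fun _ hs => ⟨hp.trans hs.1.le, hs.2.le.trans hq⟩)
  have i1 := integrableOn_sub_rpow_mul hγ₀ (x := y) (hm le_rfl (hxy.trans hy))
    (ae_restrict_Ioo_of_Icc hB le_rfl (hxy.trans hy))
  have i2 := integrableOn_sub_rpow_mul hγ₀ (x := y) (hm hx hy) (ae_restrict_Ioo_of_Icc hB hx hy)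
  have i3 := integrableOn_sub_rpow_mul hγ₀ (x := x) (hm le_rfl (hxy.trans hy))
    (ae_restrict_Ioo_of_Icc hB le_rfl (hxy.trans hy))
  have e : abelIntegral γ h y - abelIntegral γ h x =
      (∫ s in Ioo 0 x, ((y - s) ^ (γ - 1) * h s - (x - s) ^ (γ - 1) * h s)) +
        ∫ s in Ioo x y, (y - s) ^ (γ - 1) * h s := by
    rw [abelIntegral, abelIntegral, integral_Ioo_split hx hxy i1 i2, integral_sub i1 i3]
    ring
  have b1 := abs_integral_Ioo_sub_rpow_mul_le hγ₀ hxy le_rfl (ae_restrict_Ioo_of_Icc hB hx hy)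
  have b2 : |∫ s in Ioo 0 x, ((y - s) ^ (γ - 1) * h s - (x - s) ^ (γ - 1) * h s)| ≤
      B * (x ^ γ / γ - (y ^ γ - (y - x) ^ γ) / γ) := by
    have ex := integral_Ioo_sub_rpow hγ₀ (x := x) hx
    have ey := integral_Ioo_sub_rpow hγ₀ (x := y) hx
    rw [sub_self, Real.zero_rpow hγ₀.ne', sub_zero, sub_zero] at ex
    rw [sub_zero] at ey
    rw [← ex, ← ey, ← integral_sub (integrableOn_sub_rpow hγ₀ x 0 x)
      (integrableOn_sub_rpow hγ₀ y 0 x), ← integral_const_mul]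
    have hi : IntegrableOn (fun s => B * ((x - s) ^ (γ - 1) - (y - s) ^ (γ - 1))) (Ioo 0 x) :=
      ((integrableOn_sub_rpow hγ₀ x 0 x).sub (integrableOn_sub_rpow hγ₀ y 0 x)).const_mul B
    rw [← Real.norm_eq_abs]
    refine norm_integral_le_of_norm_le hi ?_
    filter_upwards [ae_restrict_Ioo_of_Icc hB le_rfl (hxy.trans hy),
      ae_restrict_mem measurableSet_Ioo] with s hs hsm
    have hle : (y - s) ^ (γ - 1) ≤ (x - s) ^ (γ - 1) :=
      Real.rpow_le_rpow_of_nonpos (by linarith [hsm.2]) (by linarith) (by linarith)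
    rw [Real.norm_eq_abs, ← sub_mul, abs_mul, abs_sub_comm, abs_of_nonneg (by linarith), mul_comm]
    exact mul_le_mul_of_nonneg_right hs (by linarith)
  rw [sub_self, Real.zero_rpow hγ₀.ne', sub_zero] at b1
  have hmono : x ^ γ ≤ y ^ γ := Real.rpow_le_rpow hx hxy hγ₀.le
  rw [e]
  refine (abs_add_le _ _).trans ((add_le_add b2 b1).trans ?_)
  have : B * (x ^ γ / γ - (y ^ γ - (y - x) ^ γ) / γ) + B * ((y - x) ^ γ / γ) =
      2 * B / γ * (y - x) ^ γ - B / γ * (y ^ γ - x ^ γ) := by field_simp; ring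
  rw [this]
  have : 0 ≤ B / γ * (y ^ γ - x ^ γ) := mul_nonneg (by positivity) (by linarith)
  linarith

lemma continuousOn_abelIntegral (hγ₀ : 0 < γ) (hγ₁ : γ < 1) {a B : ℝ}
    (hh : AEStronglyMeasurable h (volume.restrict (Icc 0 a)))
    (hB : ∀ᵐ s ∂(volume.restrict (Icc 0 a)), |h s| ≤ B) (hB0 : 0 ≤ B) :
    ContinuousOn (abelIntegral γ h) (Icc 0 a) := by
  intro x hx
  have hlim : Filter.Tendsto (fun y => 2 * B / γ * |y - x| ^ γ) (nhdsWithin x (Icc 0 a))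
      (nhds 0) := by
    have : Continuous fun y : ℝ => 2 * B / γ * |y - x| ^ γ :=
      continuous_const.mul ((continuous_id.sub continuous_const).abs.rpow_const
        fun _ => Or.inr hγ₀.le)
    have h2 := (this.tendsto x).mono_left (nhdsWithin_le_nhds (s := Icc 0 a))
    simpa [Real.zero_rpow hγ₀.ne'] using h2
  rw [ContinuousWithinAt, tendsto_iff_dist_tendsto_zero]
  refine squeeze_zero' (Filter.Eventually.of_forall fun _ => dist_nonneg) ?_ hlim
  filter_upwards [self_mem_nhdsWithin] with y hy
  rw [Real.dist_eq]
  rcases le_total x y with hxy | hxy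
  · rw [abs_of_nonneg (sub_nonneg.2 hxy)]
    exact abs_abelIntegral_sub_le hγ₀ hγ₁ hh hB hB0 hx.1 hxy hy.2
  · rw [abs_sub_comm, abs_sub_comm y x, abs_of_nonneg (sub_nonneg.2 hxy)]
    exact abs_abelIntegral_sub_le hγ₀ hγ₁ hh hB hB0 hy.1 hxy hx.2

end

/-- Gronwall inequality for the Abel kernel: the maximum of `e^(-lam t) |d t|` is at most `D` plus half
of itself. -/
lemma abs_le_of_abel_gronwall {γ c D lam a : ℝ} {d : ℝ → ℝ} (hγ₀ : 0 < γ) (hc : 0 ≤ c) (hD : 0 ≤ D)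
    (hlam : 0 < lam) (hsmall : c * (Real.Gamma γ * (1 / lam) ^ γ) ≤ 1 / 2)
    (hd : ContinuousOn d (Icc 0 a))
    (hle : ∀ t ∈ Icc 0 a, |d t| ≤ D + c * abelIntegral γ (fun s => |d s|) t) :
    ∀ t ∈ Icc 0 a, |d t| ≤ 2 * Real.exp (lam * t) * D := by
  intro t₀ ht₀
  have hcont : ContinuousOn (fun t => Real.exp (-(lam * t)) * |d t|) (Icc 0 a) :=
    (Continuous.continuousOn (by fun_prop)).mul hd.abs
  obtain ⟨t, ht, hmax⟩ := isCompact_Icc.exists_isMaxOn ⟨t₀, ht₀⟩ hcont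
  set A := Real.exp (-(lam * t)) * |d t| with hA
  have hA0 : 0 ≤ A := by positivity
  have hbd : ∀ s ∈ Icc 0 a, |d s| ≤ A * Real.exp (lam * s) := by
    intro s hs
    have h1 : Real.exp (-(lam * s)) * |d s| ≤ A := hmax hs
    calc |d s| = (Real.exp (-(lam * s)) * |d s|) * Real.exp (lam * s) := by
          rw [mul_right_comm, ← Real.exp_add]; simp
      _ ≤ A * Real.exp (lam * s) := mul_le_mul_of_nonneg_right h1 (Real.exp_pos _).le
  have hker : ∫ s in Ioo 0 t, (t - s) ^ (γ - 1) * Real.exp (-(lam * (t - s))) ≤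
      Real.Gamma γ * (1 / lam) ^ γ := by
    have hG := Real.integral_rpow_mul_exp_neg_mul_Ioi hγ₀ hlam
    have hGi : IntegrableOn (fun r : ℝ => r ^ (γ - 1) * Real.exp (-(lam * r))) (Ioi 0) := by
      by_contra hn
      rw [integral_undef hn] at hG
      have := Real.Gamma_pos_of_pos hγ₀
      have : 0 < (1 / lam) ^ γ * Real.Gamma γ := by positivity
      linarith
    rw [← integral_Ioc_eq_integral_Ioo, ← intervalIntegral.integral_of_le ht.1,
      intervalIntegral.integral_comp_sub_left (fun r => r ^ (γ - 1) * Real.exp (-(lam * r))) t,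
      sub_self, sub_zero, intervalIntegral.integral_of_le ht.1, mul_comm, ← hG]
    refine setIntegral_mono_set hGi ?_ Ioc_subset_Ioi_self.eventuallyLE
    filter_upwards [ae_restrict_mem measurableSet_Ioi] with r hr
    exact mul_nonneg (Real.rpow_nonneg (le_of_lt hr) _) (Real.exp_pos _).le
  have habel : abelIntegral γ (fun s => |d s|) t ≤
      A * Real.exp (lam * t) * (Real.Gamma γ * (1 / lam) ^ γ) := by
    refine le_trans ?_ (mul_le_mul_of_nonneg_left hker (by positivity))
    rw [abelIntegral, ← integral_const_mul]
    have hi : IntegrableOn (fun s => (t - s) ^ (γ - 1) * Real.exp (-(lam * (t - s))))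
        (Ioo 0 t) := by
      refine (integrableOn_sub_rpow hγ₀ t 0 t).mul_bdd (c := 1)
        (Continuous.aestronglyMeasurable (by fun_prop)) ?_
      filter_upwards [ae_restrict_mem measurableSet_Ioo] with s hs
      rw [Real.norm_of_nonneg (Real.exp_pos _).le, Real.exp_le_one_iff]
      nlinarith [hs.2]
    refine integral_mono_of_nonneg ?_ (hi.const_mul _) ?_
    · filter_upwards [ae_restrict_mem measurableSet_Ioo] with s hs
      exact mul_nonneg (Real.rpow_nonneg (by linarith [hs.2]) _) (abs_nonneg _)
    · filter_upwards [ae_restrict_mem measurableSet_Ioo] with s hs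
      have h1 := hbd s ⟨hs.1.le, hs.2.le.trans ht.2⟩
      have h0 : 0 ≤ (t - s) ^ (γ - 1) := Real.rpow_nonneg (by linarith [hs.2]) _
      refine (mul_le_mul_of_nonneg_left h1 h0).trans (le_of_eq ?_)
      have : Real.exp (lam * s) = Real.exp (lam * t) * Real.exp (-(lam * (t - s))) := by
        rw [← Real.exp_add]; congr 1; ring
      rw [this]; ring
  have h2 : A ≤ D + A / 2 := by
    have e1 : Real.exp (-(lam * t)) * Real.exp (lam * t) = 1 := by rw [← Real.exp_add]; simp
    have e2 : Real.exp (-(lam * t)) ≤ 1 := by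
      rw [Real.exp_le_one_iff]; nlinarith [ht.1]
    have hnn := (Real.exp_pos (-(lam * t))).le
    calc A ≤ Real.exp (-(lam * t)) *
          (D + c * (A * Real.exp (lam * t) * (Real.Gamma γ * (1 / lam) ^ γ))) :=
          mul_le_mul_of_nonneg_left
            ((hle t ht).trans (by gcongr)) hnn
      _ = Real.exp (-(lam * t)) * D + (Real.exp (-(lam * t)) * Real.exp (lam * t)) * A *
          (c * (Real.Gamma γ * (1 / lam) ^ γ)) := by ring
      _ ≤ 1 * D + 1 * A * (1 / 2) := by rw [e1]; gcongr
      _ = D + A / 2 := by ring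
  calc |d t₀| ≤ A * Real.exp (lam * t₀) := hbd t₀ ht₀
    _ ≤ 2 * D * Real.exp (lam * t₀) := by gcongr; linarith
    _ = _ := by ring

/-! ### Positivity up to a first zero -/

section
variable {γ δ : ℝ}

lemma integrableOn_Iio_powKernel_div (hγ₁ : γ < 1) (hδ : 0 < δ) (b : ℝ) :
    IntegrableOn (fun x => powKernel (-γ) x / (δ + x)) (Iio b) := by
  have h := integrableOn_Iio_powKernel (show -1 < -γ by linarith) b
  refine Integrable.mono' (h.div_const δ) ?_ (Filter.Eventually.of_forall fun x => ?_)
  · exact (h.aestronglyMeasurable.aemeasurable.div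
      (measurable_const.add measurable_id).aemeasurable).aestronglyMeasurable
  · rcases lt_or_ge x 0 with hx | hx
    · simp [powKernel_of_neg hx]
    · have := powKernel_nonneg (-γ) x
      rw [Real.norm_of_nonneg (div_nonneg this (by linarith))]
      exact div_le_div_of_nonneg_left this hδ (by linarith)

lemma integral_powKernel_div_mul_powKernel (hδ : 0 < δ) {y : ℝ}
    (hy : 0 < y) : ∫ x, powKernel (-γ) x / (δ + x) * powKernel (γ - 1) (y - x) =
      betaConst γ * δ ^ (-γ) * (y + δ) ^ (γ - 1) := by
  have h := integral_beta_moebius (γ := γ) hy (show 0 < δ / (y + δ) by positivity)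
  have e : ∀ s, powKernel (-γ) (y - s) / (δ + (y - s)) * powKernel (γ - 1) (y - (y - s)) =
      (Icc 0 y).indicator (fun s : ℝ => (y + δ)⁻¹ *
        (s ^ (γ - 1) * (y - s) ^ (-γ) * (y / (y - (1 - δ / (y + δ)) * s)))) s := by
    intro s
    by_cases hs : s ∈ Icc 0 y
    · rw [indicator_of_mem hs, powKernel_of_nonneg (by linarith [hs.2]), sub_sub_cancel,
        powKernel_of_nonneg hs.1]
      have h1 : y - (1 - δ / (y + δ)) * s = y * (δ + (y - s)) / (y + δ) := by
        field_simp; ring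
      have h2 : 0 < δ + (y - s) := by linarith [hs.2]
      rw [h1]
      field_simp
    · rw [indicator_of_notMem hs, sub_sub_cancel]
      rcases lt_or_ge s 0 with h0 | h0
      · rw [powKernel_of_neg h0, mul_zero]
      · have : y < s := not_le.1 fun h' => hs ⟨h0, h'⟩
        rw [powKernel_of_neg (by linarith), zero_div, zero_mul]
  rw [← integral_sub_left_eq_self _ volume y]
  simp_rw [e]
  rw [integral_indicator measurableSet_Icc, integral_Icc_eq_integral_Ioo, integral_const_mul, h,
    Real.div_rpow hδ.le (by positivity), Real.rpow_neg (show 0 ≤ y + δ by positivity),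
    Real.rpow_sub_one (show y + δ ≠ 0 by positivity)]
  have := Real.rpow_pos_of_pos (show 0 < y + δ by positivity) γ
  field_simp

/-- The weights with which the history enters in `integral_weight_mul_abelIntegral` have total mass at
most one, after normalization. -/
lemma integral_powKernel_div_le (hγ₀ : 0 < γ) (hγ₁ : γ < 1) (hδ : 0 < δ) {a : ℝ} (ha : 0 < a) :
    ∫ x in Ioo 0 a, powKernel (-γ) x / (δ + x) ≤ betaConst γ * δ ^ (-γ) := by
  have h := integral_powKernel_div_mul_powKernel (γ := γ) hδ ha
  have hJ := betaConst_pos hγ₀ hγ₁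
  have hδγ := Real.rpow_pos_of_pos hδ (-γ)
  have hpos : 0 < ∫ x, powKernel (-γ) x / (δ + x) * powKernel (γ - 1) (a - x) := by
    rw [h]; positivity
  have hint : Integrable fun x => powKernel (-γ) x / (δ + x) * powKernel (γ - 1) (a - x) := by
    by_contra hn
    rw [integral_undef hn] at hpos
    exact lt_irrefl _ hpos
  have hnn : ∀ x, 0 ≤ powKernel (-γ) x / (δ + x) * powKernel (γ - 1) (a - x) := fun x => by
    rcases lt_or_ge x 0 with hx | hx
    · simp [powKernel_of_neg hx]
    · exact mul_nonneg (div_nonneg (powKernel_nonneg _ _) (by linarith)) (powKernel_nonneg _ _)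
  have haγ := Real.rpow_pos_of_pos ha (γ - 1)
  refine le_of_mul_le_mul_right ?_ haγ
  calc (∫ x in Ioo 0 a, powKernel (-γ) x / (δ + x)) * a ^ (γ - 1)
      = ∫ x in Ioo 0 a, powKernel (-γ) x / (δ + x) * a ^ (γ - 1) := (integral_mul_const _ _).symm
    _ ≤ ∫ x in Ioo 0 a, powKernel (-γ) x / (δ + x) * powKernel (γ - 1) (a - x) := by
        refine setIntegral_mono_on (((integrableOn_Iio_powKernel_div hγ₁ hδ a).mono_set
          Ioo_subset_Iio_self).mul_const _) hint.integrableOn measurableSet_Ioo fun x hx => ?_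
        have h1 : a ^ (γ - 1) ≤ powKernel (γ - 1) (a - x) := by
          rw [powKernel_of_nonneg (by linarith [hx.2])]
          exact Real.rpow_le_rpow_of_nonpos (by linarith [hx.2]) (by linarith [hx.1])
            (by linarith)
        exact mul_le_mul_of_nonneg_left h1
          (div_nonneg (powKernel_nonneg _ _) (by linarith [hx.1]))
    _ ≤ ∫ x, powKernel (-γ) x / (δ + x) * powKernel (γ - 1) (a - x) :=
        setIntegral_le_integral hint (Filter.Eventually.of_forall hnn)
    _ = betaConst γ * δ ^ (-γ) * (a + δ) ^ (γ - 1) := h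
    _ ≤ betaConst γ * δ ^ (-γ) * a ^ (γ - 1) :=
        mul_le_mul_of_nonneg_left
          (Real.rpow_le_rpow_of_nonpos ha (by linarith) (by linarith)) (by positivity)

/-- The part of the Abel integral at time `a + δ` that comes from `[0, a]` is a weighted integral, with
positive weights, of the values of the Abel integral on `[0, a]`. -/
lemma integral_weight_mul_abelIntegral (hγ₀ : 0 < γ) (hγ₁ : γ < 1) (hδ : 0 < δ) {a B : ℝ}
    (ha : 0 < a) {p : ℝ → ℝ} (hp : AEStronglyMeasurable p (volume.restrict (Icc 0 a)))
    (hB : ∀ᵐ s ∂(volume.restrict (Icc 0 a)), |p s| ≤ B) :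
    ∫ x in Ioo 0 a, powKernel (-γ) x / (δ + x) * abelIntegral γ p (a - x) =
      betaConst γ * δ ^ (-γ) * ∫ s in Ioo 0 a, (a + δ - s) ^ (γ - 1) * p s := by
  set q : ℝ → ℝ := (Icc 0 a).indicator p with hq
  have hqm : AEStronglyMeasurable q := (aestronglyMeasurable_indicator_iff measurableSet_Icc).2 hp
  have hqB : ∀ᵐ s, ‖q s‖ ≤ |B| := by
    rw [ae_restrict_iff' measurableSet_Icc] at hB
    filter_upwards [hB] with s hs
    by_cases hsm : s ∈ Icc 0 a
    · rw [hq, indicator_of_mem hsm]; exact (hs hsm).trans (le_abs_self B)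
    · rw [hq, indicator_of_notMem hsm, norm_zero]; exact abs_nonneg B
  have hmp := (Measure.measurePreserving_sub_left (volume : Measure ℝ) a).quasiMeasurePreserving
  have hswap := (integral_causal_swap (b := a + 1) (g := fun y => q (a - y))
    (integrableOn_Iio_powKernel_div hγ₁ hδ _)
    (integrableOn_Iio_powKernel (show -1 < γ - 1 by linarith) _)
    (fun s hs => by rw [powKernel_of_neg hs, zero_div]) (fun _ => powKernel_of_neg)
    (hqm.comp_quasiMeasurePreserving hmp) (hmp.ae hqB)
    (fun x hx => indicator_of_notMem (fun h => by linarith [h.1]) _)).2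
  have hin : ∀ x, ∫ y, powKernel (γ - 1) (y - x) * q (a - y) = abelIntegral γ q (a - x) := by
    intro x
    rw [← integral_cutoff_mul_powKernel, ← integral_sub_left_eq_self _ volume a]
    congr 1; ext s
    have hcut : cutoff q s = q s := by
      rcases lt_or_ge s 0 with hs | hs
      · rw [cutoff_of_neg hs, hq, indicator_of_notMem fun h => by linarith [h.1]]
      · rw [cutoff_of_nonneg hs]
    rw [hcut, sub_sub_cancel, mul_comm, sub_right_comm]
  -- on `[0, a]` the Abel integral only sees the values of `p` there
  have hqp : ∀ x, 0 ≤ x → abelIntegral γ q (a - x) = abelIntegral γ p (a - x) := fun x hx =>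
    setIntegral_congr_fun measurableSet_Ioo fun s hs => by
      simp only [hq]
      rw [indicator_of_mem (mem_Icc.2 ⟨hs.1.le, by linarith [hs.2]⟩)]
  simp only [hin] at hswap
  have hL : ∫ x, powKernel (-γ) x / (δ + x) * abelIntegral γ q (a - x) =
      ∫ x in Ioo 0 a, powKernel (-γ) x / (δ + x) * abelIntegral γ p (a - x) := by
    rw [← integral_Icc_eq_integral_Ioo, ← setIntegral_eq_integral_of_forall_compl_eq_zero
      (s := Icc 0 a)]
    · exact setIntegral_congr_fun measurableSet_Icc fun x hx => by simp only [hqp x hx.1]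
    · intro x hx
      rcases lt_or_ge x 0 with h0 | h0
      · rw [powKernel_of_neg h0]; simp
      · have : a < x := not_le.1 fun h => hx ⟨h0, h⟩
        rw [abelIntegral, Ioo_eq_empty (by linarith)]; simp
  have hR : ∫ y, q (a - y) * ∫ x, powKernel (-γ) x / (δ + x) * powKernel (γ - 1) (y - x) =
      ∫ y in Ioo 0 a, p (a - y) * (betaConst γ * δ ^ (-γ) * (y + δ) ^ (γ - 1)) := by
    rw [← integral_Ioc_eq_integral_Ioo, ← setIntegral_eq_integral_of_forall_compl_eq_zero
      (s := Icc 0 a), integral_Icc_eq_integral_Ioc]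
    · refine setIntegral_congr_fun measurableSet_Ioc fun y hy => ?_
      simp only [hq]
      rw [integral_powKernel_div_mul_powKernel (γ := γ) hδ hy.1,
        indicator_of_mem (mem_Icc.2 ⟨by linarith [hy.2], by linarith [hy.1]⟩)]
    · intro y hy
      have : q (a - y) = 0 := indicator_of_notMem
        (fun h => hy ⟨by linarith [h.2], by linarith [h.1]⟩) _
      rw [this, zero_mul]
  have hrefl := intervalIntegral.integral_comp_sub_left (a := 0) (b := a)
    (fun s => betaConst γ * δ ^ (-γ) * ((a + δ - s) ^ (γ - 1) * p s)) a
  rw [sub_self, sub_zero, intervalIntegral.integral_of_le ha.le,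
    intervalIntegral.integral_of_le ha.le, integral_Ioc_eq_integral_Ioo,
    integral_Ioc_eq_integral_Ioo] at hrefl
  rw [← hL, hswap, hR, ← integral_const_mul, ← hrefl]
  refine setIntegral_congr_fun measurableSet_Ioo fun s _ => ?_
  rw [show a + δ - (a - s) = s + δ by ring]
  ring
end

/-- A solution of `d = d₀ + κ ∫_0^t (t - s)^(γ-1) p(s) ds`, `|p| ≤ L d`, that is nonnegative on
`[0, τ]` does not vanish at `τ`: the history up to `τ - δ` contributes at least a multiple of `δ ^ γ`
to `d τ`, and the memory of `[τ - δ, τ]` would only contribute `o(δ ^ γ)` if `d τ` were `0`. -/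
lemma pos_of_abelIntegral_eq {γ κ L d₀ τ : ℝ} {d p : ℝ → ℝ} (hγ₀ : 0 < γ) (hγ₁ : γ < 1) (hκ : 0 < κ)
    (hL : 0 < L) (hd₀ : 0 < d₀) (hτ : 0 < τ) (hd : ContinuousOn d (Icc 0 τ))
    (hnn : ∀ t ∈ Icc 0 τ, 0 ≤ d t) (heq : ∀ t ∈ Icc 0 τ, d t = d₀ + κ * abelIntegral γ p t)
    (hp : AEStronglyMeasurable p (volume.restrict (Icc 0 τ)))
    (hpL : ∀ᵐ s ∂(volume.restrict (Icc 0 τ)), |p s| ≤ L * d s) : 0 < d τ := by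
  refine lt_of_le_of_ne (hnn τ ⟨hτ.le, le_rfl⟩) fun hzero => ?_
  have hJ := betaConst_pos hγ₀ hγ₁
  -- the integral of `d` over the first half of the interval
  set c₀ : ℝ := ∫ s in (0 : ℝ)..(τ / 2), d s with hc₀
  have hc₀pos : 0 < c₀ := by
    refine intervalIntegral.integral_pos (by linarith)
      (hd.mono (Icc_subset_Icc le_rfl (by linarith)))
      (fun x hx => hnn x ⟨hx.1.le, by linarith [hx.2]⟩) ⟨0, ⟨le_rfl, by linarith⟩, ?_⟩
    rw [heq 0 ⟨le_rfl, hτ.le⟩, abelIntegral, Ioo_self]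
    simpa using hd₀
  obtain ⟨B, hB⟩ := isCompact_Icc.exists_bound_of_continuousOn hd
  have hpB : ∀ᵐ s ∂(volume.restrict (Icc 0 τ)), |p s| ≤ L * B := by
    filter_upwards [hpL, ae_restrict_mem measurableSet_Icc] with s hs hsm
    exact hs.trans (mul_le_mul_of_nonneg_left ((le_abs_self _).trans (hB s hsm)) hL.le)
  -- the history up to `τ - δ` keeps the solution above a multiple of `δ ^ γ`
  have hist : ∀ δ, 0 < δ → δ ≤ τ / 2 →
      c₀ * (τ ^ (-γ) / τ) ≤ betaConst γ * δ ^ (-γ) *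
        (d₀ + κ * ∫ s in Ioo 0 (τ - δ), (τ - s) ^ (γ - 1) * p s) := by
    intro δ hδ hδτ
    have ha : 0 < τ - δ := by linarith
    set a := τ - δ with hadef
    have hW := integral_powKernel_div_le hγ₀ hγ₁ hδ ha
    have hsub : Icc 0 a ⊆ Icc 0 τ := Icc_subset_Icc le_rfl (by linarith)
    have hI := integral_weight_mul_abelIntegral hγ₀ hγ₁ hδ ha
      (hp.mono_measure (Measure.restrict_mono_set volume hsub))
      (ae_restrict_of_ae_restrict_of_subset hsub hpB)
    rw [show a + δ = τ by rw [hadef]; ring] at hI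
    have hwi : IntegrableOn (fun x => powKernel (-γ) x / (δ + x)) (Ioo 0 a) :=
      (integrableOn_Iio_powKernel_div hγ₁ hδ a).mono_set Ioo_subset_Iio_self
    have hdc : ContinuousOn (fun x => d (a - x)) (Icc 0 a) :=
      hd.comp (continuousOn_const.sub continuousOn_id)
        fun x hx => ⟨by linarith [hx.2], by linarith [hx.1]⟩
    have hdi : IntegrableOn (fun x => d (a - x)) (Ioo 0 a) :=
      hdc.integrableOn_Icc.mono_set Ioo_subset_Icc_self
    have hwd : IntegrableOn (fun x => powKernel (-γ) x / (δ + x) * d (a - x)) (Ioo 0 a) := by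
      refine hwi.mul_bdd (c := B) hdi.aestronglyMeasurable ?_
      filter_upwards [ae_restrict_mem measurableSet_Ioo] with x hx
      exact hB _ ⟨by linarith [hx.2], by linarith [hx.1]⟩
    have hV : ∫ x in Ioo 0 a, powKernel (-γ) x / (δ + x) * d (a - x) =
        d₀ * (∫ x in Ioo 0 a, powKernel (-γ) x / (δ + x)) +
          κ * ∫ x in Ioo 0 a, powKernel (-γ) x / (δ + x) * abelIntegral γ p (a - x) := by
      have : ∫ x in Ioo 0 a, κ * (powKernel (-γ) x / (δ + x) * abelIntegral γ p (a - x)) =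
          ∫ x in Ioo 0 a, (powKernel (-γ) x / (δ + x) * d (a - x) -
            d₀ * (powKernel (-γ) x / (δ + x))) :=
        setIntegral_congr_fun measurableSet_Ioo fun x hx => by
          rw [heq (a - x) ⟨by linarith [hx.2], by linarith [hx.1]⟩]; ring
      rw [← integral_const_mul κ, this, integral_sub hwd (hwi.const_mul d₀), integral_const_mul]
      ring
    have hVlow : c₀ * (τ ^ (-γ) / τ) ≤
        ∫ x in Ioo 0 a, powKernel (-γ) x / (δ + x) * d (a - x) := by
      have h1 : c₀ ≤ ∫ x in Ioo 0 a, d (a - x) := by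
        rw [← integral_Ioc_eq_integral_Ioo, ← intervalIntegral.integral_of_le ha.le,
          intervalIntegral.integral_comp_sub_left d a, sub_self, sub_zero]
        refine intervalIntegral.integral_mono_interval le_rfl (by linarith) (by linarith) ?_ ?_
        · filter_upwards [ae_restrict_mem measurableSet_Ioc] with x hx
          exact hnn x ⟨hx.1.le, by linarith [hx.2]⟩
        · exact (hd.mono (by rw [uIcc_of_le ha.le]; exact hsub)).intervalIntegrable
      have hτγ := Real.rpow_pos_of_pos hτ (-γ)
      refine (mul_le_mul_of_nonneg_right h1 (by positivity)).trans ?_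
      rw [← integral_mul_const]
      refine setIntegral_mono_on (hdi.mul_const _) hwd measurableSet_Ioo fun x hx => ?_
      rw [mul_comm]
      refine mul_le_mul_of_nonneg_right ?_ (hnn _ ⟨by linarith [hx.2], by linarith [hx.1]⟩)
      rw [powKernel_of_nonneg hx.1.le]
      have hx1 : 0 < δ + x := by linarith [hx.1]
      have hx2 : δ + x ≤ τ := by linarith [hx.2]
      exact div_le_div₀ (Real.rpow_nonneg hx.1.le _)
        (Real.rpow_le_rpow_of_nonpos hx.1 (by linarith [hx.2]) (by linarith)) hx1 hx2
    rw [hI] at hV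
    rw [hV] at hVlow
    calc _ ≤ _ := hVlow
      _ ≤ d₀ * (betaConst γ * δ ^ (-γ)) + κ * (betaConst γ * δ ^ (-γ) *
          ∫ s in Ioo 0 a, (τ - s) ^ (γ - 1) * p s) := by gcongr
      _ = _ := by ring
  -- the remaining memory is of smaller order, because `d` vanishes at `τ`
  set c₁ : ℝ := c₀ * (τ ^ (-γ) / τ) / betaConst γ with hc₁
  have hτγ := Real.rpow_pos_of_pos hτ (-γ)
  have hc₁pos : 0 < c₁ := by positivity
  -- on `[τ - δ, τ]`, `d ≤ ε` makes the remaining memory at most half of the lower bound `c₁ * δ ^ γ`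
  set ε : ℝ := c₁ * γ / (2 * κ * L) with hε
  have hεpos : 0 < ε := by positivity
  have hcw : ContinuousWithinAt d (Icc 0 τ) τ := hd τ ⟨hτ.le, le_rfl⟩
  obtain ⟨η, hη, hηd⟩ := Metric.continuousWithinAt_iff.1 hcw ε hεpos
  set δ : ℝ := min (η / 2) (τ / 2) with hδdef
  have hδ : 0 < δ := lt_min (by linarith) (by linarith)
  have hδη : δ ≤ η / 2 := min_le_left _ _
  have hδτ : δ ≤ τ / 2 := min_le_right _ _
  have hsmall : ∀ᵐ s ∂(volume.restrict (Ioo (τ - δ) τ)), |p s| ≤ L * ε := by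
    filter_upwards [ae_restrict_Ioo_of_Icc hpL (show 0 ≤ τ - δ by linarith) le_rfl,
      ae_restrict_mem measurableSet_Ioo] with s hs hsm
    refine hs.trans (mul_le_mul_of_nonneg_left ?_ hL.le)
    have := hηd (x := s) ⟨by linarith [hsm.1], hsm.2.le⟩ (by
      rw [Real.dist_eq, abs_sub_comm, abs_of_pos (by linarith [hsm.2])]; linarith [hsm.1])
    rw [Real.dist_eq, ← hzero, sub_zero] at this
    exact (le_abs_self _).trans this.le
  have hrest := abs_integral_Ioo_sub_rpow_mul_le hγ₀ (x := τ) (by linarith) le_rfl hsmall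
  rw [sub_self, Real.zero_rpow hγ₀.ne', sub_zero, sub_sub_cancel] at hrest
  have hm : ∀ {x y : ℝ}, 0 ≤ x → y ≤ τ → AEStronglyMeasurable p (volume.restrict (Ioo x y)) :=
    fun hx hy => hp.mono_measure (Measure.restrict_mono_set volume
      fun _ hs => ⟨hx.trans hs.1.le, hs.2.le.trans hy⟩)
  have hsplit := integral_Ioo_split (show 0 ≤ τ - δ by linarith) (show τ - δ ≤ τ by linarith)
    (integrableOn_sub_rpow_mul hγ₀ (x := τ) (hm le_rfl (by linarith))
      (ae_restrict_Ioo_of_Icc hpB le_rfl (by linarith)))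
    (integrableOn_sub_rpow_mul hγ₀ (x := τ) (hm (by linarith) le_rfl)
      (ae_restrict_Ioo_of_Icc hpB (by linarith) le_rfl))
  have hτeq := heq τ ⟨hτ.le, le_rfl⟩
  rw [← hzero, abelIntegral, hsplit] at hτeq
  have hδγ := Real.rpow_pos_of_pos hδ γ
  have hh := hist δ hδ hδτ
  rw [Real.rpow_neg hδ.le] at hh
  have hlow : c₁ * δ ^ γ ≤ d₀ + κ * ∫ s in Ioo 0 (τ - δ), (τ - s) ^ (γ - 1) * p s := by
    rw [hc₁, div_mul_eq_mul_div, div_le_iff₀ hJ]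
    have := mul_le_mul_of_nonneg_right hh hδγ.le
    refine this.trans (le_of_eq ?_)
    field_simp
  have hup : -(c₁ * δ ^ γ / 2) ≤ κ * ∫ s in Ioo (τ - δ) τ, (τ - s) ^ (γ - 1) * p s := by
    have h1 := mul_le_mul_of_nonneg_left (neg_le_of_abs_le hrest) hκ.le
    refine le_trans (le_of_eq ?_) h1
    rw [hε]; field_simp
  have : 0 < c₁ * δ ^ γ := by positivity
  linarith

/-! ### Solutions of the Caputo equation -/

lemma ae_abs_le_of_eLpNorm_top_le {μ : Measure ℝ} {u : ℝ → ℝ} {M : ℝ} (hM : 0 ≤ M)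
    (h : eLpNorm u ∞ μ ≤ ENNReal.ofReal M) : ∀ᵐ t ∂μ, |u t| ≤ M := by
  rw [eLpNorm_exponent_top] at h
  filter_upwards [ae_le_eLpNormEssSup (f := u) (μ := μ)] with t ht
  have := ht.trans h
  rwa [← ofReal_norm, ENNReal.ofReal_le_ofReal_iff hM] at this

lemma exists_ae_abs_le_of_memLp_top {μ : Measure ℝ} {u : ℝ → ℝ} (h : MemLp u ∞ μ) :
    ∃ M : ℝ, 0 < M ∧ ∀ᵐ t ∂μ, |u t| ≤ M := by
  refine ⟨(eLpNorm u ∞ μ).toReal + 1, by positivity, ?_⟩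
  refine ae_abs_le_of_eLpNorm_top_le (by positivity) ?_
  refine le_trans ?_ (ENNReal.ofReal_le_ofReal (le_add_of_nonneg_right zero_le_one))
  rw [ENNReal.ofReal_toReal h.eLpNorm_ne_top]

section
variable {f : ℝ → ℝ → ℝ} {a M : ℝ}

lemma IsLocLipschitzSource.exists_ae_lipschitz (hLip : IsLocLipschitzSource f) (a M : ℝ) :
    ∃ L : ℝ, 0 < L ∧ ∀ᵐ t ∂(volume.restrict (Icc 0 a)), ∀ v w : ℝ, |v| ≤ M → |w| ≤ M →
      |f t v - f t w| ≤ L * |v - w| := by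
  obtain ⟨L, hL, h⟩ := hLip (Icc 0 a ×ˢ Icc (-M) M) (isCompact_Icc.prod isCompact_Icc)
    (prod_mono (fun _ hx => hx.1) (subset_univ _))
  refine ⟨L, hL, ?_⟩
  rw [ae_restrict_iff' measurableSet_Icc]
  filter_upwards [h] with t ht hta v w hv hw
  exact ht v w ⟨hta, abs_le.1 hv⟩ ⟨hta, abs_le.1 hw⟩

/-- The essential bound of `f` in both variables yields, for almost every `t`, a bound on `f t v` for
*every* `v`: it holds for some `w` by Fubini, and passes to `v` by the Lipschitz condition. -/
lemma IsLocBddSource.exists_ae_bound (hf : IsLocBddSource f) (hLip : IsLocLipschitzSource f)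
    (a : ℝ) {M : ℝ} (hM : 0 < M) : ∃ B : ℝ, 0 ≤ B ∧ ∀ᵐ t ∂(volume.restrict (Icc 0 a)),
      ∀ v : ℝ, |v| ≤ M → |f t v| ≤ B := by
  obtain ⟨L, hL, hlip⟩ := hLip.exists_ae_lipschitz a M
  have hmem := hf (Icc 0 a ×ˢ Icc (-M) M) (isCompact_Icc.prod isCompact_Icc)
    (prod_mono (fun _ hx => hx.1) (subset_univ _))
  set B := (eLpNorm (fun p : ℝ × ℝ => f p.1 p.2) ∞
    (volume.restrict (Icc 0 a ×ˢ Icc (-M) M))).toReal with hB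
  have hae := ae_le_eLpNormEssSup (f := fun p : ℝ × ℝ => f p.1 p.2)
    (μ := volume.restrict (Icc 0 a ×ˢ Icc (-M) M))
  rw [Measure.volume_eq_prod, ← Measure.prod_restrict] at hae
  refine ⟨B + L * (2 * M), by positivity, ?_⟩
  filter_upwards [hlip, Measure.ae_ae_of_ae_prod hae] with t hlt ht v hv
  have hne : (ae (volume.restrict (Icc (-M) M))).NeBot := by
    rw [ae_neBot, Ne, Measure.restrict_eq_zero, Real.volume_Icc]
    simp [hM]
  obtain ⟨w, hw, hwM⟩ := (ht.and (ae_restrict_mem measurableSet_Icc)).exists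
  have hfw : |f t w| ≤ B := by
    rw [Measure.prod_restrict, ← Measure.volume_eq_prod, ← eLpNorm_exponent_top] at hw
    have := ENNReal.toReal_mono hmem.eLpNorm_ne_top hw
    rwa [toReal_enorm] at this
  have hwM := abs_le.2 hwM
  have h1 : |v - w| ≤ 2 * M := (abs_sub _ _).trans (by linarith)
  calc |f t v| = |f t w + (f t v - f t w)| := by ring_nf
    _ ≤ |f t w| + |f t v - f t w| := abs_add_le _ _
    _ ≤ B + L * (2 * M) := add_le_add hfw
        ((hlt v w hv hwM).trans (mul_le_mul_of_nonneg_left h1 hL.le))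

end

/-- The continuous version `u₀ + κ ∫_0^t (t - s)^(γ-1) f(s, u(s)) ds` of a weak solution `u`. -/
noncomputable def mildVersion (γ : ℝ) (f : ℝ → ℝ → ℝ) (u₀ : ℝ) (u : ℝ → ℝ) (t : ℝ) : ℝ :=
  u₀ + abelConst γ * abelIntegral γ (fun s => f s (u s)) t

lemma mildVersion_zero (γ : ℝ) (f : ℝ → ℝ → ℝ) (u₀ : ℝ) (u : ℝ → ℝ) :
    mildVersion γ f u₀ u 0 = u₀ := by
  simp [mildVersion, abelIntegral]

section
variable {γ : ℝ} {f : ℝ → ℝ → ℝ} {T T₁ T₂ : EReal} {u₀ u₁₀ u₂₀ : ℝ} {u u₁ u₂ : ℝ → ℝ}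

lemma IsWeakSolution.aestronglyMeasurable_rhs (hu : IsWeakSolution γ f T u₀ u) {a : ℝ}
    (ha : (a : EReal) < T) :
    AEStronglyMeasurable (fun t => f t (u t)) (volume.restrict (Icc 0 a)) :=
  (hu.locallyIntegrable_rhs.integrableOn_compact_subset (Icc_subset_timeInterval ha)
    isCompact_Icc).aestronglyMeasurable

lemma exists_ae_bound_rhs (hf : IsLocBddSource f) (hLip : IsLocLipschitzSource f)
    (hb : IsLocBddOn T u) {a : ℝ} (ha0 : 0 ≤ a) (ha : (a : EReal) < T) :
    ∃ B : ℝ, 0 ≤ B ∧ ∀ᵐ t ∂(volume.restrict (Icc 0 a)), |f t (u t)| ≤ B := by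
  obtain ⟨M, hM, hMu⟩ := exists_ae_abs_le_of_memLp_top (hb a ha0 ha)
  obtain ⟨B, hB, hBf⟩ := hf.exists_ae_bound hLip a hM
  refine ⟨B, hB, ?_⟩
  filter_upwards [hMu, hBf] with t h1 h2 using h2 _ h1

lemma IsWeakSolution.continuousOn_mildVersion (hγ₀ : 0 < γ) (hγ₁ : γ < 1)
    (hf : IsLocBddSource f) (hLip : IsLocLipschitzSource f)
    (hu : IsWeakSolution γ f T u₀ u) (hb : IsLocBddOn T u) :
    ContinuousOn (mildVersion γ f u₀ u) (timeInterval T) := by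
  intro t ht
  obtain ⟨b, htb, hbT⟩ := EReal.lt_iff_exists_real_btwn.1 ht.2
  have htb : t < b := by exact_mod_cast htb
  obtain ⟨B, hB0, hB⟩ := exists_ae_bound_rhs hf hLip hb (ht.1.trans htb.le) hbT
  have h := (continuousOn_const (c := u₀)).add ((continuousOn_const (c := abelConst γ)).mul
    (continuousOn_abelIntegral hγ₀ hγ₁ (hu.aestronglyMeasurable_rhs hbT) hB hB0))
  refine (h t ⟨ht.1, htb.le⟩).mono_of_mem_nhdsWithin ?_
  filter_upwards [self_mem_nhdsWithin, mem_nhdsWithin_of_mem_nhds (Iio_mem_nhds htb)] with s h1 h2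
  exact ⟨h1.1, le_of_lt h2⟩

lemma IsWeakSolution.isContinuousVersion_mildVersion (hγ₀ : 0 < γ) (hγ₁ : γ < 1) (hT : 0 < T)
    (hf : IsLocBddSource f) (hLip : IsLocLipschitzSource f)
    (hu : IsWeakSolution γ f T u₀ u) (hb : IsLocBddOn T u) :
    IsContinuousVersion T u (mildVersion γ f u₀ u) :=
  ⟨hu.continuousOn_mildVersion hγ₀ hγ₁ hf hLip hb, hu.ae_eq_abelIntegral hγ₀ hγ₁ hT⟩

lemma IsWeakSolution.mildVersion_sub (hγ₀ : 0 < γ) (hf : IsLocBddSource f)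
    (hLip : IsLocLipschitzSource f)
    (hu₁ : IsWeakSolution γ f T₁ u₁₀ u₁) (hb₁ : IsLocBddOn T₁ u₁)
    (hu₂ : IsWeakSolution γ f T₂ u₂₀ u₂) (hb₂ : IsLocBddOn T₂ u₂)
    {a : ℝ} (ha₁ : (a : EReal) < T₁) (ha₂ : (a : EReal) < T₂) :
    ∀ t ∈ Icc 0 a, mildVersion γ f u₂₀ u₂ t - mildVersion γ f u₁₀ u₁ t =
      (u₂₀ - u₁₀) + abelConst γ * abelIntegral γ (fun s => f s (u₂ s) - f s (u₁ s)) t := by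
  intro t ht
  have ha0 : 0 ≤ a := ht.1.trans ht.2
  have hi : ∀ {T : EReal} {u₀ : ℝ} {u : ℝ → ℝ}, IsWeakSolution γ f T u₀ u → IsLocBddOn T u →
      (a : EReal) < T → IntegrableOn (fun s => (t - s) ^ (γ - 1) * f s (u s)) (Ioo 0 t) := by
    intro T u₀ u hu hb haT
    obtain ⟨B, -, hB⟩ := exists_ae_bound_rhs hf hLip hb ha0 haT
    exact integrableOn_sub_rpow_mul hγ₀ ((hu.aestronglyMeasurable_rhs haT).mono_measure
      (Measure.restrict_mono_set volume fun s hs => ⟨hs.1.le, hs.2.le.trans ht.2⟩))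
      (ae_restrict_Ioo_of_Icc hB le_rfl ht.2)
  have : abelIntegral γ (fun s => f s (u₂ s) - f s (u₁ s)) t =
      abelIntegral γ (fun s => f s (u₂ s)) t - abelIntegral γ (fun s => f s (u₁ s)) t := by
    simp only [abelIntegral, mul_sub]
    exact integral_sub (hi hu₂ hb₂ ha₂) (hi hu₁ hb₁ ha₁)
  rw [this, mildVersion, mildVersion]
  ring

lemma ae_abs_rhs_sub_le (hγ₀ : 0 < γ) (hγ₁ : γ < 1)
    (hu₁ : IsWeakSolution γ f T₁ u₁₀ u₁) (hu₂ : IsWeakSolution γ f T₂ u₂₀ u₂)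
    {a M L : ℝ} (ha0 : 0 ≤ a) (ha₁ : (a : EReal) < T₁) (ha₂ : (a : EReal) < T₂)
    (hL : ∀ᵐ t ∂(volume.restrict (Icc 0 a)), ∀ v w : ℝ, |v| ≤ M → |w| ≤ M →
      |f t v - f t w| ≤ L * |v - w|)
    (hM₁ : ∀ᵐ t ∂(volume.restrict (Icc 0 a)), |u₁ t| ≤ M)
    (hM₂ : ∀ᵐ t ∂(volume.restrict (Icc 0 a)), |u₂ t| ≤ M) :
    ∀ᵐ t ∂(volume.restrict (Icc 0 a)), |f t (u₂ t) - f t (u₁ t)| ≤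
      L * |mildVersion γ f u₂₀ u₂ t - mildVersion γ f u₁₀ u₁ t| := by
  have ha0' : (0 : EReal) ≤ a := by exact_mod_cast ha0
  filter_upwards [hL, hM₁, hM₂, ae_restrict_of_ae_restrict_of_subset
    (Icc_subset_timeInterval ha₁) (hu₁.ae_eq_abelIntegral hγ₀ hγ₁ (ha0'.trans_lt ha₁)),
    ae_restrict_of_ae_restrict_of_subset
    (Icc_subset_timeInterval ha₂) (hu₂.ae_eq_abelIntegral hγ₀ hγ₁ (ha0'.trans_lt ha₂))]
    with t h1 h2 h3 h4 h5
  have h := h1 _ _ h3 h2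
  rw [mildVersion, mildVersion, ← h4, ← h5]
  exact h

lemma mildVersion_stability (hγ₀ : 0 < γ) (hγ₁ : γ < 1) (hf : IsLocBddSource f)
    (hLip : IsLocLipschitzSource f) (T' : ℝ) (M : ℝ) :
    ∃ C : ℝ, 0 < C ∧ ∀ (T₁ T₂ : EReal) (u₁₀ u₂₀ : ℝ) (u₁ u₂ : ℝ → ℝ),
      IsWeakSolution γ f T₁ u₁₀ u₁ → IsLocBddOn T₁ u₁ →
      IsWeakSolution γ f T₂ u₂₀ u₂ → IsLocBddOn T₂ u₂ →
      ∀ a : ℝ, 0 ≤ a → a ≤ T' → (a : EReal) < T₁ → (a : EReal) < T₂ →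
      (∀ᵐ t ∂(volume.restrict (Icc 0 a)), |u₁ t| ≤ M) →
      (∀ᵐ t ∂(volume.restrict (Icc 0 a)), |u₂ t| ≤ M) →
      ∀ t ∈ Icc 0 a, |mildVersion γ f u₁₀ u₁ t - mildVersion γ f u₂₀ u₂ t| ≤
        C * |u₁₀ - u₂₀| := by
  obtain ⟨L, hL, hlip⟩ := hLip.exists_ae_lipschitz T' M
  have hκ := abelConst_pos hγ₀ hγ₁
  have hΓ := Real.Gamma_pos_of_pos hγ₀
  -- the rate `lam` is chosen so that `c * Γ(γ) * lam ^ (-γ) = 1 / 2`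
  set c := abelConst γ * L with hc
  have hc0 : 0 < c := mul_pos hκ hL
  set lam : ℝ := (2 * c * Real.Gamma γ) ^ (1 / γ) with hlamdef
  have hlam : 0 < lam := Real.rpow_pos_of_pos (by positivity) _
  have hsmall : c * (Real.Gamma γ * (1 / lam) ^ γ) ≤ 1 / 2 := by
    rw [Real.div_rpow zero_le_one hlam.le, Real.one_rpow, hlamdef,
      ← Real.rpow_mul (by positivity), one_div_mul_cancel hγ₀.ne', Real.rpow_one]
    apply le_of_eq
    field_simp
  refine ⟨2 * Real.exp (lam * T'), by positivity, ?_⟩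
  intro T₁ T₂ u₁₀ u₂₀ u₁ u₂ hu₁ hb₁ hu₂ hb₂ a ha0 haT ha₁ ha₂ hM₁ hM₂ t ht
  have hlip' := ae_restrict_of_ae_restrict_of_subset
    (Icc_subset_Icc (le_refl (0 : ℝ)) haT) hlip
  have hp := ae_abs_rhs_sub_le hγ₀ hγ₁ hu₁ hu₂ ha0 ha₁ ha₂ hlip' hM₁ hM₂
  have hd : ContinuousOn (fun t => mildVersion γ f u₂₀ u₂ t - mildVersion γ f u₁₀ u₁ t)
      (Icc 0 a) :=
    ((hu₂.continuousOn_mildVersion hγ₀ hγ₁ hf hLip hb₂).mono (Icc_subset_timeInterval ha₂)).sub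
      ((hu₁.continuousOn_mildVersion hγ₀ hγ₁ hf hLip hb₁).mono (Icc_subset_timeInterval ha₁))
  have hG := abs_le_of_abel_gronwall (D := |u₂₀ - u₁₀|) hγ₀ hc0.le (abs_nonneg _) hlam hsmall hd ?_ t ht
  · rw [abs_sub_comm, abs_sub_comm u₁₀]
    refine hG.trans ?_
    have : t ≤ T' := ht.2.trans haT
    gcongr
  · intro s hs
    rw [hu₁.mildVersion_sub hγ₀ hf hLip hb₁ hu₂ hb₂ ha₁ ha₂ s hs]
    refine (abs_add_le _ _).trans (add_le_add le_rfl ?_)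
    rw [abs_mul, abs_of_pos hκ, hc, mul_assoc]
    refine mul_le_mul_of_nonneg_left ?_ hκ.le
    rw [abelIntegral, abelIntegral, ← integral_const_mul, ← Real.norm_eq_abs]
    have hdc := hd.abs.mono (Icc_subset_Icc (le_refl (0 : ℝ)) hs.2)
    obtain ⟨B, hB⟩ := isCompact_Icc.exists_bound_of_continuousOn hdc
    have hi : IntegrableOn (fun r => (s - r) ^ (γ - 1) *
        |mildVersion γ f u₂₀ u₂ r - mildVersion γ f u₁₀ u₁ r|) (Ioo 0 s) :=
      integrableOn_sub_rpow_mul hγ₀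
        (hdc.integrableOn_Icc.mono_set Ioo_subset_Icc_self).aestronglyMeasurable
        (by filter_upwards [ae_restrict_mem measurableSet_Ioo] with r hr
            exact hB r ⟨hr.1.le, hr.2.le⟩)
    refine norm_integral_le_of_norm_le (Integrable.const_mul hi L) ?_
    filter_upwards [ae_restrict_Ioo_of_Icc hp le_rfl hs.2, ae_restrict_mem measurableSet_Ioo]
      with r hr hrm
    have h0 : 0 ≤ (s - r) ^ (γ - 1) := Real.rpow_nonneg (by linarith [hrm.2]) _
    rw [Real.norm_eq_abs, abs_mul, abs_of_nonneg h0]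
    refine (mul_le_mul_of_nonneg_left hr h0).trans (le_of_eq (by ring))

lemma mildVersion_lt (hγ₀ : 0 < γ) (hγ₁ : γ < 1) (hf : IsLocBddSource f)
    (hLip : IsLocLipschitzSource f)
    (hu₁ : IsWeakSolution γ f T₁ u₁₀ u₁) (hb₁ : IsLocBddOn T₁ u₁)
    (hu₂ : IsWeakSolution γ f T₂ u₂₀ u₂) (hb₂ : IsLocBddOn T₂ u₂) (h0 : u₁₀ < u₂₀)
    {t : ℝ} (ht : t ∈ timeInterval (min T₁ T₂)) :
    mildVersion γ f u₁₀ u₁ t < mildVersion γ f u₂₀ u₂ t := by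
  by_contra hn
  have ht₁ := ht.2.trans_le (min_le_left _ _)
  have ht₂ := ht.2.trans_le (min_le_right _ _)
  set d : ℝ → ℝ := fun t => mildVersion γ f u₂₀ u₂ t - mildVersion γ f u₁₀ u₁ t with hddef
  have hd : ContinuousOn d (Icc 0 t) :=
    ((hu₂.continuousOn_mildVersion hγ₀ hγ₁ hf hLip hb₂).mono (Icc_subset_timeInterval ht₂)).sub
      ((hu₁.continuousOn_mildVersion hγ₀ hγ₁ hf hLip hb₁).mono (Icc_subset_timeInterval ht₁))
  have hd0 : 0 < d 0 := by
    simp only [hddef, mildVersion_zero]; linarith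
  -- `τ` is the first time at which the difference is not positive
  have hS : IsCompact (Icc 0 t ∩ d ⁻¹' Iic 0) :=
    isCompact_Icc.of_isClosed_subset
      (hd.preimage_isClosed_of_isClosed isClosed_Icc isClosed_Iic) inter_subset_left
  obtain ⟨τ, ⟨hτt, hτd⟩, hτmin⟩ := hS.exists_isLeast
    ⟨t, ⟨ht.1, le_rfl⟩, by simp only [hddef, mem_preimage, mem_Iic]; linarith⟩
  have hτ0 : 0 < τ := lt_of_le_of_ne hτt.1 fun h => by
    rw [← h] at hτd; exact absurd hd0 (not_lt.2 hτd)
  have hpos : ∀ s ∈ Ico 0 τ, 0 < d s := fun s hs => by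
    by_contra hs'
    exact absurd (hτmin ⟨⟨hs.1, hs.2.le.trans hτt.2⟩, not_lt.1 hs'⟩) (not_le.2 hs.2)
  have hdτ : ContinuousOn d (Icc 0 τ) := hd.mono (Icc_subset_Icc le_rfl hτt.2)
  have hτnn : 0 ≤ d τ := by
    have hcl : τ ∈ closure (Ico 0 τ) := by
      rw [closure_Ico hτ0.ne]; exact ⟨hτ0.le, le_rfl⟩
    have := mem_closure_iff_nhdsWithin_neBot.1 hcl
    exact ge_of_tendsto ((hdτ τ ⟨hτ0.le, le_rfl⟩).mono Ico_subset_Icc_self).tendsto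
      (by filter_upwards [self_mem_nhdsWithin] with s hs using (hpos s hs).le)
  have hnn : ∀ s ∈ Icc 0 τ, 0 ≤ d s := fun s hs => by
    rcases hs.2.lt_or_eq with h | h
    · exact (hpos s ⟨hs.1, h⟩).le
    · rw [h]; exact hτnn
  have hτ₁ : (τ : EReal) < T₁ := (EReal.coe_le_coe_iff.2 hτt.2).trans_lt ht₁
  have hτ₂ : (τ : EReal) < T₂ := (EReal.coe_le_coe_iff.2 hτt.2).trans_lt ht₂
  obtain ⟨M₁, -, hM₁⟩ := exists_ae_abs_le_of_memLp_top (hb₁ τ hτ0.le hτ₁)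
  obtain ⟨M₂, -, hM₂⟩ := exists_ae_abs_le_of_memLp_top (hb₂ τ hτ0.le hτ₂)
  obtain ⟨L, hL, hlip⟩ := hLip.exists_ae_lipschitz τ (max M₁ M₂)
  have hp := ae_abs_rhs_sub_le hγ₀ hγ₁ hu₁ hu₂ hτ0.le hτ₁ hτ₂ hlip
    (hM₁.mono fun _ h => h.trans (le_max_left _ _)) (hM₂.mono fun _ h => h.trans (le_max_right _ _))
  have := pos_of_abelIntegral_eq hγ₀ hγ₁ (abelConst_pos hγ₀ hγ₁) hL (sub_pos.2 h0) hτ0 hdτ hnn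
    (hu₁.mildVersion_sub hγ₀ hf hLip hb₁ hu₂ hb₂ hτ₁ hτ₂)
    ((hu₂.aestronglyMeasurable_rhs hτ₂).sub (hu₁.aestronglyMeasurable_rhs hτ₁)) (by
      filter_upwards [hp, ae_restrict_mem measurableSet_Icc] with s hs hsm
      have h := hnn s hsm
      rwa [← abs_of_nonneg h])
  exact absurd this (not_lt.2 hτd)

lemma measurableSet_timeInterval (T : EReal) : MeasurableSet (timeInterval T) :=
  measurableSet_Ici.inter (openBefore T).isOpen.measurableSet

lemma mildVersion_eq (hγ₀ : 0 < γ) (hγ₁ : γ < 1) (hf : IsLocBddSource f)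
    (hLip : IsLocLipschitzSource f)
    (hu₁ : IsWeakSolution γ f T₁ u₀ u₁) (hb₁ : IsLocBddOn T₁ u₁)
    (hu₂ : IsWeakSolution γ f T₂ u₀ u₂) (hb₂ : IsLocBddOn T₂ u₂)
    {t : ℝ} (ht : t ∈ timeInterval (min T₁ T₂)) :
    mildVersion γ f u₀ u₁ t = mildVersion γ f u₀ u₂ t := by
  have ht₁ := ht.2.trans_le (min_le_left _ _)
  have ht₂ := ht.2.trans_le (min_le_right _ _)
  obtain ⟨M₁, -, hM₁⟩ := exists_ae_abs_le_of_memLp_top (hb₁ t ht.1 ht₁)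
  obtain ⟨M₂, -, hM₂⟩ := exists_ae_abs_le_of_memLp_top (hb₂ t ht.1 ht₂)
  obtain ⟨C, -, hC⟩ := mildVersion_stability hγ₀ hγ₁ hf hLip t (max M₁ M₂)
  have := hC T₁ T₂ u₀ u₀ u₁ u₂ hu₁ hb₁ hu₂ hb₂ t ht.1 le_rfl ht₁ ht₂
    (hM₁.mono fun _ h => h.trans (le_max_left _ _)) (hM₂.mono fun _ h => h.trans (le_max_right _ _))
    t ⟨ht.1, le_rfl⟩
  rw [sub_self, abs_zero, mul_zero] at this
  exact sub_eq_zero.1 (abs_nonpos_iff.1 this)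

lemma timeInterval_mono {S T : EReal} (h : S ≤ T) : timeInterval S ⊆ timeInterval T :=
  fun _ hx => ⟨hx.1, hx.2.trans_le h⟩

end

theorem mainTheorem3 (γ : ℝ) (hγ₀ : 0 < γ) (hγ₁ : γ < 1) (f : ℝ → ℝ → ℝ)
    (hf : IsLocBddSource f) (hLip : IsLocLipschitzSource f) :
    -- uniqueness
    (∀ (T₁ T₂ : EReal) (u₀ : ℝ) (u₁ u₂ : ℝ → ℝ), 0 < T₁ → 0 < T₂ →
      IsWeakSolution γ f T₁ u₀ u₁ → IsLocBddOn T₁ u₁ →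
      IsWeakSolution γ f T₂ u₀ u₂ → IsLocBddOn T₂ u₂ →
      u₁ =ᵐ[volume.restrict (timeInterval (min T₁ T₂))] u₂) ∧
    -- strict monotonicity in the initial value
    (∀ (T₁ T₂ : EReal) (u₁₀ u₂₀ : ℝ) (u₁ u₂ : ℝ → ℝ), 0 < T₁ → 0 < T₂ →
      IsWeakSolution γ f T₁ u₁₀ u₁ → IsLocBddOn T₁ u₁ →
      IsWeakSolution γ f T₂ u₂₀ u₂ → IsLocBddOn T₂ u₂ →
      u₁₀ < u₂₀ →
      ∃ v₁ v₂ : ℝ → ℝ,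
        IsContinuousVersion T₁ u₁ v₁ ∧ v₁ 0 = u₁₀ ∧
        IsContinuousVersion T₂ u₂ v₂ ∧ v₂ 0 = u₂₀ ∧
        ∀ t ∈ timeInterval (min T₁ T₂), v₁ t < v₂ t) ∧
    -- Lipschitz stability in the initial value
    (∀ T M : ℝ, 0 < T → 0 < M → ∃ C : ℝ, 0 < C ∧
      ∀ (T₁ T₂ : EReal) (u₁₀ u₂₀ : ℝ) (u₁ u₂ : ℝ → ℝ), (T : EReal) ≤ T₁ → (T : EReal) ≤ T₂ →
        IsWeakSolution γ f T₁ u₁₀ u₁ → IsLocBddOn T₁ u₁ →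
        IsWeakSolution γ f T₂ u₂₀ u₂ → IsLocBddOn T₂ u₂ →
        eLpNorm u₁ ∞ (volume.restrict (Icc 0 T)) ≤ ENNReal.ofReal M →
        eLpNorm u₂ ∞ (volume.restrict (Icc 0 T)) ≤ ENNReal.ofReal M →
        eLpNorm (u₁ - u₂) ∞ (volume.restrict (Icc 0 T)) ≤
          ENNReal.ofReal (C * |u₁₀ - u₂₀|)) := by
  refine ⟨?_, ?_, ?_⟩
  · intro T₁ T₂ u₀ u₁ u₂ hT₁ hT₂ hu₁ hb₁ hu₂ hb₂
    have h₁ := ae_restrict_of_ae_restrict_of_subset (timeInterval_mono (min_le_left T₁ T₂))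
      (hu₁.isContinuousVersion_mildVersion hγ₀ hγ₁ hT₁ hf hLip hb₁).2
    have h₂ := ae_restrict_of_ae_restrict_of_subset (timeInterval_mono (min_le_right T₁ T₂))
      (hu₂.isContinuousVersion_mildVersion hγ₀ hγ₁ hT₂ hf hLip hb₂).2
    filter_upwards [h₁, h₂, ae_restrict_mem (measurableSet_timeInterval _)] with t e₁ e₂ ht
    rw [e₁, e₂, mildVersion_eq hγ₀ hγ₁ hf hLip hu₁ hb₁ hu₂ hb₂ ht]
  · intro T₁ T₂ u₁₀ u₂₀ u₁ u₂ hT₁ hT₂ hu₁ hb₁ hu₂ hb₂ h0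
    exact ⟨mildVersion γ f u₁₀ u₁, mildVersion γ f u₂₀ u₂,
      hu₁.isContinuousVersion_mildVersion hγ₀ hγ₁ hT₁ hf hLip hb₁, mildVersion_zero _ _ _ _,
      hu₂.isContinuousVersion_mildVersion hγ₀ hγ₁ hT₂ hf hLip hb₂, mildVersion_zero _ _ _ _,
      fun t ht => mildVersion_lt hγ₀ hγ₁ hf hLip hu₁ hb₁ hu₂ hb₂ h0 ht⟩
  · intro T M hT hM
    obtain ⟨C, hC0, hC⟩ := mildVersion_stability hγ₀ hγ₁ hf hLip T M
    refine ⟨C, hC0, fun T₁ T₂ u₁₀ u₂₀ u₁ u₂ hT₁ hT₂ hu₁ hb₁ hu₂ hb₂ hn₁ hn₂ => ?_⟩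
    have hT0 : (0 : EReal) < T := by exact_mod_cast hT
    have hM₁ := ae_abs_le_of_eLpNorm_top_le hM.le hn₁
    have hM₂ := ae_abs_le_of_eLpNorm_top_le hM.le hn₂
    have hsub₁ : Ico 0 T ⊆ timeInterval T₁ := fun t ht =>
      ⟨ht.1, (EReal.coe_lt_coe_iff.2 ht.2).trans_le hT₁⟩
    have hsub₂ : Ico 0 T ⊆ timeInterval T₂ := fun t ht =>
      ⟨ht.1, (EReal.coe_lt_coe_iff.2 ht.2).trans_le hT₂⟩
    have h₁ := ae_restrict_of_ae_restrict_of_subset hsub₁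
      (hu₁.ae_eq_abelIntegral hγ₀ hγ₁ (hT0.trans_le hT₁))
    have h₂ := ae_restrict_of_ae_restrict_of_subset hsub₂
      (hu₂.ae_eq_abelIntegral hγ₀ hγ₁ (hT0.trans_le hT₂))
    rw [restrict_Ico_eq_restrict_Icc] at h₁ h₂
    -- the weak solutions need not extend to `T` itself, so the endpoint is discarded
    have hne : ∀ᵐ t ∂(volume.restrict (Icc 0 T)), t ≠ T :=
      ae_restrict_of_ae (by simp [ae_iff])
    rw [eLpNorm_exponent_top]
    refine eLpNormEssSup_le_of_ae_bound ?_
    filter_upwards [h₁, h₂, hne, ae_restrict_mem measurableSet_Icc] with t e₁ e₂ htne ht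
    have htT : t ∈ Ico 0 T := ⟨ht.1, lt_of_le_of_ne ht.2 htne⟩
    have hsub : Icc 0 t ⊆ Icc 0 T := Icc_subset_Icc le_rfl ht.2
    have := hC T₁ T₂ u₁₀ u₂₀ u₁ u₂ hu₁ hb₁ hu₂ hb₂ t ht.1 ht.2 (hsub₁ htT).2 (hsub₂ htT).2
      (ae_restrict_of_ae_restrict_of_subset hsub hM₁)
      (ae_restrict_of_ae_restrict_of_subset hsub hM₂) t ⟨ht.1, le_rfl⟩
    rw [Pi.sub_apply, e₁, e₂]
    exact this
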